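/- Let $L\in(0,\infty)$ and let $Z\in\mathcal C^2([0,L])$ be a deterministic positive function with $Z'(0)=Z'(L)=0$. Let $B$ be a standard Brownian motion on $[0,L]$ with $B(0)=0$, let $\mathsf u,\mathsf v\in\mathbb R$, and set $B_{\mathsf v}(x)=B(x)+\mathsf v x$. For $y\in[0,L]$ and $k=0,1,2$ define $$I_k(y)=\int_0^y Z^{(k)}(x)\,e^{B_{\mathsf v}(x)}\,dx,$$ where $Z^{(k)}$ is the $k$th derivative of $Z$. Write $\mathrm E_B$ for expectation with respect to $B$. Then all the random variables whose expectations appear below are integrable, and $$\begin{aligned}\mathrm E_B\left[I_0(L)^{-\mathsf u-\mathsf v-1}I_2(L)\right]={}&-\left(\mathsf v+\tfrac12\right)Z(L)\,\mathrm E_B\left[I_0(L)^{-\mathsf u-\mathsf v-1}e^{B_{\mathsf v}(L)}\right]-\left(\mathsf u+\tfrac12\right)Z(0)\,\mathrm E_B\left[I_0(L)^{-\mathsf u-\mathsf v-1}\right]\\&+\left(\tfrac13\mathsf u^2+\tfrac13\mathsf v^2-\tfrac13\mathsf u\mathsf v-\tfrac1{12}\right)\mathrm E_B\left[I_0(L)^{-\mathsf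 u-\mathsf v}\right]\\&+(\mathsf u+\mathsf v+1)\,\mathrm E_B\left[I_0(L)^{-\mathsf u-\mathsf v-2}\int_0^L Z(y)^2e^{2B_{\mathsf v}(y)}\,dy\right].\end{aligned}$$ -/

import Mathlib

open MeasureTheory ProbabilityTheory Set
open scoped NNReal

/-- The family `(B x)_{x ∈ [0, L]}` is a standard Brownian motion on `[0, L]` with `B 0 = 0` under
the measure `P`: it starts at `0`, has independent increments, the increment over `[s, t]` is
centred Gaussian with variance `t - s`, and almost every path is continuous on `[0, L]`.
Nothing is required of `B x` for `x` outside `[0, L]`. -/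
structure IsStdBrownianOn {Ω : Type*} [MeasurableSpace Ω] (L : ℝ) (B : ℝ → Ω → ℝ)
    (P : Measure Ω) : Prop where
  zero_ae : ∀ᵐ ω ∂P, B 0 ω = 0
  indep_increments : HasIndepIncrements (fun (t : Icc (0 : ℝ) L) ω => B t ω) P
  law_increment : ∀ s t : ℝ, 0 ≤ s → s ≤ t → t ≤ L →
    HasLaw (fun ω => B t ω - B s ω) (gaussianReal 0 (Real.toNNReal (t - s))) P
  continuous_ae : ∀ᵐ ω ∂P, ContinuousOn (fun x => B x ω) (Icc (0 : ℝ) L)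

/-- The drifted process `B_v(x) = B(x) + v x`. -/
def driftedBM {Ω : Type*} (B : ℝ → Ω → ℝ) (v : ℝ) (x : ℝ) (ω : Ω) : ℝ :=
  B x ω + v * x

/-- `I_k(y) = ∫_0^y Z^{(k)}(x) e^{B_v(x)} dx`, where `Z^{(k)}` is the `k`-th derivative of `Z`
on the interval `[0, L]` (one-sided at the end points). -/
noncomputable def expIntegral {Ω : Type*} (L : ℝ) (Z : ℝ → ℝ) (B : ℝ → Ω → ℝ) (v : ℝ)
    (k : ℕ) (y : ℝ) (ω : Ω) : ℝ :=
  ∫ x in (0 : ℝ)..y, iteratedDerivWithin k Z (Icc (0 : ℝ) L) x * Real.exp (driftedBM B v x ω)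

/-! Write `X(y) = e^{B_v(y)}`, `f = Z X`, `F(y) = ∫₀ʸ f`, `F = F(L)` and `p = -u - v - 1`. Brownian
paths are not differentiable, so `∫ Z''(y) X(y) F^p dy` cannot be integrated by parts path by path.
In expectation it can. By Cameron–Martin (`IsRegularBrownian.lintegral_exp_mul`), weighting by
`e^{B(y)}` amounts, up to the factor `e^{y/2}`, to adding `min x y` to the path. Hence `E[X(y) F^p]
= E[e^{αy} H(y)^p]` with `α = v + 1/2` and `H(y) = ∫₀ᴸ f(x) e^{min x y} dx`, and the right-hand
integrand is differentiable in `y`.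

With `K(y) = ∫₀ʸ f(x) eˣ dx` one has `H' = H - K` and `K' = f eʸ`. So the functions `g_j = e^{αy}
H^{p-j} K^j` satisfy first-order linear relations, and `integral_mul_eq_of_linear_system` reduces `∫
Z'' g_0` to integrals against `Z` and boundary terms; `Z'` vanishes at both ends.

Undoing the tilt evaluates what is left. Since `Z X = F'`, the expectation of `∫ Z g_j` is
`E[F^{p+1}] / (j+1)`; the source term in `g_1'` gives the integral of `Z² X²`; the boundary terms
give `E[F^p X(L)]` and `E[F^p]`.

Integrability rests on `F ≤ H ≤ e^L F` and `0 ≤ K ≤ H`, which reduce everything to moments of `F`.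
These are all finite, by Jensen (`IsRegularBrownian.integrable_rpow`). -/

open Filter Topology
open scoped ENNReal

/-! ### Exponential tilting of Gaussian variables. -/

/-- Exponential tilting of a centred Gaussian by `e^x` is translation by the variance. -/
lemma lintegral_exp_mul_gaussianReal (t : ℝ≥0) (G : ℝ → ℝ≥0∞) (hG : Measurable G) :
    ∫⁻ a, ENNReal.ofReal (Real.exp a) * G a ∂(gaussianReal 0 t) =
      ENNReal.ofReal (Real.exp (t / 2)) * ∫⁻ a, G (a + t) ∂(gaussianReal 0 t) := by
  by_cases ht : t = 0
  · subst ht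
    simp [gaussianReal_zero_var, lintegral_dirac]
  have hmap : ∫⁻ a, G (a + t) ∂(gaussianReal 0 t) = ∫⁻ a, G a ∂(gaussianReal t t) := by
    rw [← lintegral_map hG (measurable_add_const _), gaussianReal_map_add_const, zero_add]
  have hm (μ : ℝ) : Measurable (gaussianPDF μ t) := measurable_gaussianPDF μ t
  rw [hmap, gaussianReal_of_var_ne_zero _ ht, gaussianReal_of_var_ne_zero _ ht,
    lintegral_withDensity_eq_lintegral_mul _ (hm 0) (by fun_prop),
    lintegral_withDensity_eq_lintegral_mul _ (hm t) hG, ← lintegral_const_mul _ (by fun_prop)]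
  refine lintegral_congr fun a => ?_
  simp only [Pi.mul_apply, ← mul_assoc]
  congr 1
  simp only [gaussianPDF]
  rw [← ENNReal.ofReal_mul (gaussianPDFReal_nonneg _ _ _), ← ENNReal.ofReal_mul (Real.exp_pos _).le]
  congr 1
  have ht' : (t : ℝ) ≠ 0 := by exact_mod_cast ht
  simp only [gaussianPDFReal, mul_assoc]
  rw [mul_left_comm (Real.exp _)]
  congr 1
  -- Completing the square: `a - a²/(2t) = t/2 - (a - t)²/(2t)`.
  rw [← Real.exp_add, ← Real.exp_add]
  congr 1
  field_simp
  ring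

/-- If `ξ` is a centred Gaussian independent of `η`, tilting by `e^ξ` translates `ξ` and leaves
`η` unchanged. -/
lemma lintegral_exp_mul_of_indepFun {Ω Ω' : Type*} [MeasurableSpace Ω] [MeasurableSpace Ω']
    {P : Measure Ω} [IsProbabilityMeasure P] {t : ℝ≥0} {ξ : Ω → ℝ} {η : Ω → Ω'}
    (hξ : Measurable ξ) (hη : Measurable η) (hlaw : P.map ξ = gaussianReal 0 t)
    (hind : IndepFun ξ η P) {G : ℝ × Ω' → ℝ≥0∞} (hG : Measurable G) :
    ∫⁻ ω, ENNReal.ofReal (Real.exp (ξ ω)) * G (ξ ω, η ω) ∂P =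
      ENNReal.ofReal (Real.exp (t / 2)) * ∫⁻ ω, G (ξ ω + t, η ω) ∂P := by
  have hprod := hind.map_prod_eq_prod_map_map hξ.aemeasurable hη.aemeasurable
  have hpair : Measurable fun ω => (ξ ω, η ω) := hξ.prodMk hη
  have : IsProbabilityMeasure (P.map η) := Measure.isProbabilityMeasure_map hη.aemeasurable
  have key (K : ℝ × Ω' → ℝ≥0∞) (hK : Measurable K) :
      ∫⁻ ω, K (ξ ω, η ω) ∂P = ∫⁻ z, ∫⁻ a, K (a, z) ∂(gaussianReal 0 t) ∂(P.map η) := by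
    rw [← lintegral_map hK hpair, hprod, hlaw, lintegral_prod_symm _ hK.aemeasurable]
  rw [key (fun p => ENNReal.ofReal (Real.exp p.1) * G p) (by fun_prop),
    key (fun p => G (p.1 + t, p.2)) (by fun_prop), ← lintegral_const_mul _ (by fun_prop)]
  exact lintegral_congr fun z => lintegral_exp_mul_gaussianReal t (fun a => G (a, z)) (by fun_prop)

/-! ### A regular version of Brownian motion on `[0, L]`. -/

/-- The coordinates `W t`, `t ∈ [0, L]`, form a Brownian motion whose coordinates are measurable and
all of whose paths are continuous. -/
structure IsRegularBrownian {Ω : Type*} [MeasurableSpace Ω] (L : ℝ) (W : Icc (0 : ℝ) L → Ω → ℝ)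
    (P : Measure Ω) : Prop where
  measurable : ∀ t, Measurable (W t)
  continuous : ∀ ω, Continuous fun t => W t ω
  isGaussianProcess : IsGaussianProcess W P
  hasLaw : ∀ t, HasLaw (W t) (gaussianReal 0 (Real.toNNReal t)) P
  covariance : ∀ s t, cov[W s, W t; P] = min (s : ℝ) t

section Regular

variable {Ω : Type*} [MeasurableSpace Ω] {P : Measure Ω} {L : ℝ}

lemma IsStdBrownianOn.hasLaw_eval {B : ℝ → Ω → ℝ} (hB : IsStdBrownianOn L B P) {t : ℝ}
    (ht : t ∈ Icc 0 L) : HasLaw (B t) (gaussianReal 0 (Real.toNNReal t)) P := by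
  have h := hB.law_increment 0 t le_rfl ht.1 ht.2
  rw [sub_zero] at h
  refine h.congr ?_
  filter_upwards [hB.zero_ae] with ω hω
  simp [hω]

/-- Almost surely, a Brownian motion on `[0, L]` agrees on all of `[0, L]` with a process whose
coordinates are measurable and all of whose paths are continuous. -/
lemma IsStdBrownianOn.exists_measurable_continuous {B : ℝ → Ω → ℝ} (hB : IsStdBrownianOn L B P)
    (hL : 0 < L) :
    ∃ W : Icc (0 : ℝ) L → Ω → ℝ, (∀ t, Measurable (W t)) ∧ (∀ ω, Continuous fun t => W t ω) ∧
      ∀ᵐ ω ∂P, ∀ t : Icc (0 : ℝ) L, B t ω = W t ω := by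
  classical
  have hm (t : Icc (0 : ℝ) L) : AEMeasurable (B t) P := (hB.hasLaw_eval t.2).aemeasurable
  have : Nonempty (Icc (0 : ℝ) L) := ⟨⟨0, le_rfl, hL.le⟩⟩
  let q : ℕ → Icc (0 : ℝ) L := TopologicalSpace.denseSeq _
  have hgood : ∀ᵐ ω ∂P, ContinuousOn (fun x => B x ω) (Icc (0 : ℝ) L) ∧
      ∀ n, B (q n) ω = (hm (q n)).mk (B (q n)) ω :=
    hB.continuous_ae.and (ae_all_iff.2 fun n => (hm (q n)).ae_eq_mk)
  obtain ⟨S, hSP, hSm, hS⟩ := hgood.exists_measurable_mem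
  -- The path is kept on the full-measure set `S` and set to zero elsewhere. Each coordinate is then
  -- a limit of measurable coordinates taken along a countable dense set of times.
  refine ⟨fun t ω => S.indicator (fun ω => B t ω) ω, fun t => ?_, fun ω => ?_, ?_⟩
  · have ht : t ∈ closure (range q) := (TopologicalSpace.denseRange_denseSeq _) t
    obtain ⟨a, ha, hat⟩ := mem_closure_iff_seq_limit.1 ht
    choose i hi using ha
    refine measurable_of_tendsto_metrizable
      (f := fun n => S.indicator ((hm (q (i n))).mk (B (q (i n)))))
      (fun n => ((hm (q (i n))).measurable_mk).indicator hSm) ?_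
    refine tendsto_pi_nhds.2 fun ω => ?_
    by_cases hω : ω ∈ S
    · simp only [indicator_of_mem hω]
      have hc : Continuous fun t : Icc (0 : ℝ) L => B t ω := (hS ω hω).1.domRestrict
      have := (hc.tendsto t).comp hat
      refine this.congr fun n => ?_
      simp only [Function.comp_apply]
      rw [← (hS ω hω).2 (i n), hi n]
    · simp [indicator_of_notMem hω]
  · by_cases hω : ω ∈ S
    · simp only [indicator_of_mem hω]
      exact (hS ω hω).1.domRestrict
    · simp only [indicator_of_notMem hω]
      exact continuous_const
  · filter_upwards [hSP] with ω hω t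
    rw [indicator_of_mem hω]

/-- Independent Gaussian increments started from zero form a Gaussian process. For `s ≤ t`, writing
`W t = W s + (W t - W s)` with independent summands leaves the variance of `W s` as covariance. -/
lemma IsStdBrownianOn.exists_isRegularBrownian [IsProbabilityMeasure P] {B : ℝ → Ω → ℝ}
    (hB : IsStdBrownianOn L B P) (hL : 0 < L) :
    ∃ W : Icc (0 : ℝ) L → Ω → ℝ, IsRegularBrownian L W P ∧
      ∀ᵐ ω ∂P, ∀ t : Icc (0 : ℝ) L, B t ω = W t ω := by
  obtain ⟨W, hWm, hWc, hBW⟩ := hB.exists_measurable_continuous hL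
  refine ⟨W, ?_, hBW⟩
  have heq (t : Icc (0 : ℝ) L) : (fun ω => B t ω) =ᵐ[P] W t := by
    filter_upwards [hBW] with ω hω using hω t
  have : Fact ((0 : ℝ) ≤ L) := ⟨hL.le⟩
  have hbot : ∀ᵐ ω ∂P, (fun (t : Icc (0 : ℝ) L) ω => B t ω) ⊥ ω = 0 := hB.zero_ae
  have hlawB (t : Icc (0 : ℝ) L) :
      HasLaw (fun ω => B t ω) (gaussianReal 0 (Real.toNNReal t)) P := hB.hasLaw_eval t.2
  have hlaw (t : Icc (0 : ℝ) L) : HasLaw (W t) (gaussianReal 0 (Real.toNNReal t)) P :=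
    (hlawB t).congr (heq t).symm
  have hgB : IsGaussianProcess (fun (t : Icc (0 : ℝ) L) ω => B t ω) P :=
    hB.indep_increments.isGaussianProcess (fun t => (hlawB t).hasGaussianLaw) hbot
  have hgW : IsGaussianProcess W P := hgB.congr heq
  refine ⟨hWm, hWc, hgW, hlaw, ?_⟩
  have hcov (s t : Icc (0 : ℝ) L) (hst : s ≤ t) : cov[W s, W t; P] = s := by
    have h1 : (W s) ⟂ᵢ[P] (W t - W s) := by
      refine (hB.indep_increments.indepFun_eval_sub bot_le hst hbot).congr (heq s) ?_
      exact (heq t).sub (heq s)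
    have h2 : W t = W t - W s + W s := by simp
    have m (t : Icc (0 : ℝ) L) : MemLp (W t) 2 P := (hlaw t).hasGaussianLaw.memLp_two
    rw [h2, covariance_add_right (m s) ((m t).sub (m s)) (m s),
      h1.covariance_eq_zero (m s) ((m t).sub (m s)), covariance_self (hWm s).aemeasurable,
      (hlaw s).variance_eq, variance_id_gaussianReal]
    simp [s.2.1]
  intro s t
  rcases le_total s t with h | h
  · rw [hcov s t h, min_eq_left (by exact_mod_cast h)]
  · rw [covariance_comm, hcov t s h, min_eq_right (by exact_mod_cast h)]

end Regular

/-! ### The Cameron–Martin formula, by splitting off a Brownian bridge. -/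

lemma measurable_intervalIntegral_of_continuous {Ω : Type*} [MeasurableSpace Ω] {φ : ℝ → Ω → ℝ}
    (hc : ∀ ω, Continuous fun x => φ x ω) (hm : ∀ x, Measurable (φ x)) (a b : ℝ) :
    Measurable fun ω => ∫ x in a..b, φ x ω := by
  have hu : Measurable (Function.uncurry φ) :=
    measurable_uncurry_of_continuous_of_measurable hc hm
  have hu' : Measurable fun p : Ω × ℝ => φ p.2 p.1 := hu.comp measurable_swap
  simp only [intervalIntegral]
  exact (hu'.stronglyMeasurable.integral_prod_right'.measurable).sub
    hu'.stronglyMeasurable.integral_prod_right'.measurable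

section CameronMartin

variable {Ω : Type*} [MeasurableSpace Ω] {P : Measure Ω} {L : ℝ} {W : Icc (0 : ℝ) L → Ω → ℝ}

/-- The Brownian bridge obtained from `W` by removing the linear dependence on `W y`. -/
noncomputable def bridgeAt (W : Icc (0 : ℝ) L → Ω → ℝ) (y t : Icc (0 : ℝ) L) (ω : Ω) : ℝ :=
  W t ω - min (t : ℝ) y / y * W y ω

lemma IsRegularBrownian.measurable_bridgeAt (hW : IsRegularBrownian L W P) (y t : Icc (0 : ℝ) L) :
    Measurable (bridgeAt W y t) :=
  (hW.measurable t).sub ((hW.measurable y).const_mul _)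

lemma IsRegularBrownian.continuous_bridgeAt (hW : IsRegularBrownian L W P) (y : Icc (0 : ℝ) L)
    (ω : Ω) : Continuous fun t => bridgeAt W y t ω := by
  have := hW.continuous ω
  unfold bridgeAt
  fun_prop

/-- `W y` and the bridge are jointly Gaussian, and the coefficient `min t y / y` is the one that
makes them uncorrelated. -/
lemma IsRegularBrownian.indepFun_bridgeAt [IsProbabilityMeasure P] (hW : IsRegularBrownian L W P)
    (y : Icc (0 : ℝ) L) : IndepFun (W y) (fun ω t => bridgeAt W y t ω) P := by
  classical
  have hg : IsGaussianProcess (Sum.elim (fun _ : Unit => W y) (bridgeAt W y)) P := by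
    refine hW.isGaussianProcess.of_isGaussianProcess fun s => ?_
    cases s with
    | inl s => exact ⟨{y}, ContinuousLinearMap.proj ⟨y, by simp⟩, fun ω => rfl⟩
    | inr t =>
      refine ⟨{t, y}, ContinuousLinearMap.proj ⟨t, by simp⟩ -
        (min (t : ℝ) y / y) • ContinuousLinearMap.proj ⟨y, by simp⟩, fun ω => rfl⟩
  have hmem (t : Icc (0 : ℝ) L) : MemLp (W t) 2 P := (hW.hasLaw t).hasGaussianLaw.memLp_two
  have h := hg.indepFun_of_covariance_eq_zero (fun _ => (hW.measurable y).aemeasurable)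
    (fun t => (hW.measurable_bridgeAt y t).aemeasurable) fun _ t => by
      have hb : bridgeAt W y t = W t - fun ω => min (t : ℝ) y / y * W y ω := rfl
      rw [hb, covariance_sub_right (hmem y) (hmem t) ((hmem y).const_mul _),
        covariance_const_mul_right, hW.covariance, hW.covariance, min_self]
      -- At `y = 0` the quotient is `0` by convention, and the covariance `min y t` vanishes as
      -- well.
      by_cases hy : (y : ℝ) = 0
      · simp [hy, t.2.1]
      · rw [div_mul_cancel₀ _ hy, min_comm, sub_self]
  exact h.comp (measurable_pi_apply ()) measurable_id

/-- Cameron–Martin formula for the tilt `e^{W y}`, which shifts `W` by `x ↦ min x y`, applied to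
functionals of `W y` and of two exponential integrals of the path. -/
theorem IsRegularBrownian.lintegral_exp_mul [IsProbabilityMeasure P]
    (hW : IsRegularBrownian L W P) (hL : 0 ≤ L) (y : Icc (0 : ℝ) L) {d : ℝ → ℝ} (hd : Continuous d)
    {G : ℝ × ℝ × ℝ → ℝ≥0∞} (hG : Measurable G) :
    ∫⁻ ω, ENNReal.ofReal (Real.exp (W y ω)) *
        G (W y ω, ∫ x in (0 : ℝ)..L, Real.exp (d x + W (projIcc 0 L hL x) ω),
          ∫ x in (0 : ℝ)..y, Real.exp (d x + W (projIcc 0 L hL x) ω)) ∂P =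
      ENNReal.ofReal (Real.exp ((y : ℝ) / 2)) *
        ∫⁻ ω, G (W y ω + y,
          ∫ x in (0 : ℝ)..L, Real.exp (d x + W (projIcc 0 L hL x) ω) * Real.exp (min x y),
          ∫ x in (0 : ℝ)..y, Real.exp (d x + W (projIcc 0 L hL x) ω) * Real.exp (min x y)) ∂P := by
  -- Bridges are viewed among continuous paths, so that integrals over time depend measurably on the
  -- path.
  let Ω' := {w : Icc (0 : ℝ) L → ℝ // Continuous w}
  let η : Ω → Ω' := fun ω => ⟨fun t => bridgeAt W y t ω, hW.continuous_bridgeAt y ω⟩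
  have hη' : Measurable fun ω t => bridgeAt W y t ω := measurable_pi_lambda _ fun t =>
    hW.measurable_bridgeAt y t
  have hη : Measurable η := hη'.subtype_mk
  have hind : IndepFun (W y) η P := by
    have := hW.indepFun_bridgeAt y
    rw [IndepFun_iff_Indep] at this ⊢
    convert this using 1
    change MeasurableSpace.comap η (MeasurableSpace.comap Subtype.val _) = _
    rw [MeasurableSpace.comap_comp]
    rfl
  -- Rebuilds the exponential path from the value at `y` and the bridge. Raising the value at `y` by
  -- `y` raises the path by `(min x y / y) * y = min x y`.
  let φ : ℝ → ℝ × Ω' → ℝ := fun x p =>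
    Real.exp (d x + min (projIcc 0 L hL x : ℝ) y / y * p.1 + p.2.1 (projIcc 0 L hL x))
  have hφc (p : ℝ × Ω') : Continuous fun x => φ x p := by
    have := p.2.2.comp (continuous_projIcc (h := hL))
    have h2 : Continuous fun x => (projIcc 0 L hL x : ℝ) :=
      continuous_subtype_val.comp continuous_projIcc
    simp only [Function.comp_def] at this
    fun_prop
  have hφm (x : ℝ) : Measurable (φ x) := by
    have : Measurable fun p : ℝ × Ω' => p.2.1 (projIcc 0 L hL x) :=
      (measurable_pi_apply _).comp (measurable_subtype_coe.comp measurable_snd)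
    fun_prop
  have hφi := measurable_intervalIntegral_of_continuous hφc hφm
  have key := lintegral_exp_mul_of_indepFun (hW.measurable y) hη (hW.hasLaw y).map_eq hind
    (G := fun p => G (p.1, ∫ x in (0 : ℝ)..L, φ x p, ∫ x in (0 : ℝ)..y, φ x p))
    (hG.comp (measurable_fst.prodMk ((hφi 0 L).prodMk (hφi 0 y))))
  have h1 (x : ℝ) (ω : Ω) : φ x (W y ω, η ω) = Real.exp (d x + W (projIcc 0 L hL x) ω) := by
    simp only [φ, η, bridgeAt]
    congr 1
    ring
  have h2 (x : ℝ) (hx : x ∈ Icc 0 L) (ω : Ω) : φ x (W y ω + y, η ω) =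
      Real.exp (d x + W (projIcc 0 L hL x) ω) * Real.exp (min x y) := by
    simp only [φ, η, bridgeAt]
    rw [← Real.exp_add, projIcc_of_mem hL hx]
    congr 1
    by_cases hy : (y : ℝ) = 0
    · simp [hy, hx.1]
    · field_simp
      ring
  have h3 (z : ℝ) (hz : z ∈ Icc 0 L) (ω : Ω) :
      ∫ x in (0 : ℝ)..z, φ x (W y ω + y, η ω) = ∫ x in (0 : ℝ)..z,
        Real.exp (d x + W (projIcc 0 L hL x) ω) * Real.exp (min x y) := by
    refine intervalIntegral.integral_congr fun x hx => h2 x ?_ ω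
    rw [uIcc_of_le hz.1] at hx
    exact ⟨hx.1, hx.2.trans hz.2⟩
  rw [Real.coe_toNNReal _ y.2.1] at key
  simp only [h1, h3 L ⟨hL, le_rfl⟩, h3 y y.2] at key
  exact key

end CameronMartin

/-! ### Finiteness of all moments of the exponential integral. -/

/-- Jensen's inequality for powers of an exponential integral. -/
lemma rpow_integral_exp_le {L r : ℝ} (hL : 0 < L) (hr : r ≤ 0 ∨ 1 ≤ r) {φ : ℝ → ℝ}
    (hφ : Continuous φ) :
    (∫ x in (0 : ℝ)..L, Real.exp (φ x)) ^ r ≤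
      L ^ (r - 1) * ∫ x in (0 : ℝ)..L, Real.exp (r * φ x) := by
  let μ : Measure ℝ := volume.restrict (Ioc 0 L)
  have hμ : μ.real univ = L := by simp [μ, hL.le]
  have : NeZero μ := ⟨fun h => by simp [h] at hμ; exact hL.ne hμ⟩
  have hint {ψ : ℝ → ℝ} (hψ : Continuous ψ) : Integrable ψ μ :=
    (hψ.integrableOn_Icc).mono_set Ioc_subset_Icc_self
  have havg {ψ : ℝ → ℝ} : ⨍ x, ψ x ∂μ = L⁻¹ * ∫ x in (0 : ℝ)..L, ψ x := by
    rw [average_eq, hμ, smul_eq_mul, intervalIntegral.integral_of_le hL.le]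
  have hpos : 0 < ∫ x in (0 : ℝ)..L, Real.exp (φ x) :=
    intervalIntegral.intervalIntegral_pos_of_pos (by fun_prop (disch := simp)
      |> fun h : Continuous fun x => Real.exp (φ x) => h.intervalIntegrable _ _)
      (fun x => Real.exp_pos _) hL
  have key : (⨍ x, Real.exp (φ x) ∂μ) ^ r ≤ ⨍ x, Real.exp (r * φ x) ∂μ := by
    rcases hr with hr | hr
    -- Jensen is used twice: it bounds the average of `e^φ` below by `exp` of the average of `φ`, a
    -- nonpositive power reverses this, and `exp` of the average of `r φ` is bounded by Jensen
    -- again.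
    · have h1 := convexOn_exp.map_average_le Real.continuous_exp.continuousOn isClosed_univ
        (by simp) (hint hφ) (hint (by fun_prop))
      have h2 := convexOn_exp.map_average_le (f := fun x => r * φ x) Real.continuous_exp.continuousOn
        isClosed_univ (by simp) (hint (by fun_prop)) (hint (by fun_prop))
      refine le_trans ?_ h2
      refine (Real.rpow_le_rpow_of_nonpos (Real.exp_pos _) h1 hr).trans_eq ?_
      rw [← Real.exp_mul, havg, havg, intervalIntegral.integral_const_mul]
      ring_nf
    · have h1 := (convexOn_rpow hr).map_average_le (f := fun x => Real.exp (φ x)) (μ := μ)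
        (continuousOn_id.rpow_const fun x _ => Or.inr (by linarith)) isClosed_Ici
        (Eventually.of_forall fun x => (Real.exp_pos _).le) (hint (by fun_prop))
        (hint (Continuous.rpow_const (by fun_prop) fun x => Or.inr (by linarith)))
      refine h1.trans_eq ?_
      simp only [← Real.exp_mul, mul_comm]
  rw [havg, havg, Real.mul_rpow (by positivity) hpos.le] at key
  have hLr : 0 < L ^ r := Real.rpow_pos_of_pos hL r
  rw [Real.inv_rpow hL.le, inv_mul_le_iff₀ hLr] at key
  rwa [Real.rpow_sub hL, Real.rpow_one, div_eq_mul_inv, mul_assoc]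

section Moments

variable {Ω : Type*} [MeasurableSpace Ω] {P : Measure Ω} {L : ℝ} {W : Icc (0 : ℝ) L → Ω → ℝ}

lemma IsRegularBrownian.continuous_projIcc (hW : IsRegularBrownian L W P) (hL : 0 ≤ L) (ω : Ω) :
    Continuous fun x => W (projIcc 0 L hL x) ω :=
  (hW.continuous ω).comp _root_.continuous_projIcc

/-- At each time the Gaussian exponential moment is `e^{x r² / 2}`, which is continuous in `x` and
so bounded on `[0, L]`. -/
lemma IsRegularBrownian.integrable_prod_exp [IsProbabilityMeasure P]
    (hW : IsRegularBrownian L W P) (hL : 0 ≤ L) {d : ℝ → ℝ} (hd : Continuous d) (r : ℝ) :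
    Integrable (fun p : Ω × ℝ => Real.exp (r * (d p.2 + W (projIcc 0 L hL p.2) p.1)))
      (P.prod (volume.restrict (Ioc 0 L))) := by
  have hm : Measurable (Function.uncurry fun (x : ℝ) (ω : Ω) =>
      Real.exp (r * (d x + W (projIcc 0 L hL x) ω))) :=
    measurable_uncurry_of_continuous_of_measurable
      (fun ω => ((hd.add (hW.continuous_projIcc hL ω)).const_mul r).rexp)
      (fun x => by have := hW.measurable (projIcc 0 L hL x); fun_prop)
  have hsplit (x : ℝ) (ω : Ω) : Real.exp (r * (d x + W (projIcc 0 L hL x) ω)) =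
      Real.exp (r * d x) * Real.exp (r * W (projIcc 0 L hL x) ω) := by
    rw [mul_add, Real.exp_add]
  have hmgf (t : Icc (0 : ℝ) L) :
      ∫ ω, Real.exp (r * W t ω) ∂P = Real.exp ((t : ℝ) * r ^ 2 / 2) := by
    have := mgf_gaussianReal (hW.hasLaw t).map_eq r
    simpa [mgf, t.2.1] using this
  have hint (t : Icc (0 : ℝ) L) : Integrable (fun ω => Real.exp (r * W t ω)) P := by
    have h := integrable_exp_mul_gaussianReal (μ := 0) (v := Real.toNNReal t) r
    rw [← (hW.hasLaw t).map_eq] at h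
    exact h.comp_measurable (hW.measurable t)
  refine (integrable_prod_iff' (hm.comp measurable_swap).aestronglyMeasurable).2
    ⟨Eventually.of_forall fun x => ?_, ?_⟩
  · simp only [Function.comp_apply, Prod.swap_prod_mk, Function.uncurry_apply_pair, hsplit]
    exact (hint _).const_mul _
  · simp only [Function.comp_apply, Prod.swap_prod_mk, Function.uncurry_apply_pair,
      Real.norm_eq_abs, hsplit, abs_mul, Real.abs_exp, integral_const_mul, hmgf]
    refine Integrable.mono_measure (ν := volume.restrict (Icc 0 L)) ?_
      (Measure.restrict_mono Ioc_subset_Icc_self le_rfl)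
    refine Continuous.integrableOn_Icc ?_
    have h2 : Continuous fun x => (projIcc 0 L hL x : ℝ) :=
      continuous_subtype_val.comp _root_.continuous_projIcc
    fun_prop

/-- All positive and negative moments of the exponential integral are finite. -/
theorem IsRegularBrownian.integrable_rpow [IsProbabilityMeasure P]
    (hW : IsRegularBrownian L W P) (hL : 0 < L) {d : ℝ → ℝ} (hd : Continuous d) (r : ℝ) :
    Integrable (fun ω => (∫ x in (0 : ℝ)..L, Real.exp (d x + W (projIcc 0 L hL.le x) ω)) ^ r) P := by
  have hc (ω : Ω) : Continuous fun x => d x + W (projIcc 0 L hL.le x) ω :=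
    hd.add (hW.continuous_projIcc hL.le ω)
  have hmeas : Measurable fun ω =>
      ∫ x in (0 : ℝ)..L, Real.exp (d x + W (projIcc 0 L hL.le x) ω) :=
    measurable_intervalIntegral_of_continuous (fun ω => (hc ω).rexp)
      (fun x => by have := hW.measurable (projIcc 0 L hL.le x); fun_prop) 0 L
  have hnn (ω : Ω) : 0 ≤ ∫ x in (0 : ℝ)..L, Real.exp (d x + W (projIcc 0 L hL.le x) ω) :=
    intervalIntegral.integral_nonneg hL.le fun x _ => (Real.exp_pos _).le
  have convexCase {q : ℝ} (hq : q ≤ 0 ∨ 1 ≤ q) : Integrable (fun ω =>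
      (∫ x in (0 : ℝ)..L, Real.exp (d x + W (projIcc 0 L hL.le x) ω)) ^ q) P := by
    have h := (hW.integrable_prod_exp hL.le hd q).integral_prod_left.const_mul (L ^ (q - 1))
    refine h.mono' (hmeas.pow_const q).aestronglyMeasurable (Eventually.of_forall fun ω => ?_)
    rw [Real.norm_of_nonneg (Real.rpow_nonneg (hnn ω) _)]
    have := rpow_integral_exp_le hL hq (hc ω)
    rwa [intervalIntegral.integral_of_le hL.le (f := fun x => Real.exp (q * _))] at this
  rcases le_total r 0 with hr | hr
  · exact convexCase (Or.inl hr)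
  -- Exponents in `(0, 1)` escape Jensen; for every `r ≥ 0` the bound `a^r ≤ 1 + a^{r+1}` suffices.
  · refine ((integrable_const 1).add (convexCase (q := r + 1) (Or.inr (by linarith)))).mono'
      (hmeas.pow_const r).aestronglyMeasurable (Eventually.of_forall fun ω => ?_)
    rw [Real.norm_of_nonneg (Real.rpow_nonneg (hnn ω) _)]
    simp only [Pi.add_apply]
    rcases le_total (∫ x in (0 : ℝ)..L, Real.exp (d x + W (projIcc 0 L hL.le x) ω)) 1 with h | h
    · linarith [Real.rpow_le_one (hnn ω) h hr, Real.rpow_nonneg (hnn ω) (r + 1)]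
    · linarith [Real.rpow_le_rpow_of_exponent_le h (by linarith : r ≤ r + 1)]

end Moments

/-! ### Integration by parts along a linear system. -/

/-- Three integrations by parts along functions `g`, `k` solving a linear system. -/
lemma integral_mul_eq_of_linear_system {L s α β : ℝ} (hL : 0 ≤ L)
    {Z Z₁ Z₂ g k m n : ℝ → ℝ} (hZ : ContinuousOn Z (Icc 0 L)) (hZ₁ : ContinuousOn Z₁ (Icc 0 L))
    (hZ₂ : ContinuousOn Z₂ (Icc 0 L)) (hZZ₁ : ∀ x ∈ Ioo 0 L, HasDerivAt Z (Z₁ x) x)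
    (hZ₁Z₂ : ∀ x ∈ Ioo 0 L, HasDerivAt Z₁ (Z₂ x) x) (h0 : Z₁ 0 = 0) (h1 : Z₁ L = 0)
    (hg : ContinuousOn g (Icc 0 L)) (hk : ContinuousOn k (Icc 0 L))
    (hm : ContinuousOn m (Icc 0 L)) (hn : ContinuousOn n (Icc 0 L))
    (hg' : ∀ x ∈ Ioo 0 L, HasDerivAt g (α * g x + s * k x) x)
    (hk' : ∀ x ∈ Ioo 0 L, HasDerivAt k (β * k x + m x + (s + 1) * n x) x)
    (hk0 : k 0 = 0) (hkL : k L = g L) :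
    ∫ x in (0 : ℝ)..L, Z₂ x * g x =
      -α * (Z L * g L - Z 0 * g 0 - α * (∫ x in (0 : ℝ)..L, Z x * g x)
          - s * ∫ x in (0 : ℝ)..L, Z x * k x)
        - s * (Z L * g L - β * (∫ x in (0 : ℝ)..L, Z x * k x) - (∫ x in (0 : ℝ)..L, Z x * m x)
          - (s + 1) * ∫ x in (0 : ℝ)..L, Z x * n x) := by
  have hu : uIcc 0 L = Icc 0 L := uIcc_of_le hL
  have hI {q : ℝ → ℝ} (hq : ContinuousOn q (Icc 0 L)) : IntervalIntegrable q volume 0 L :=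
    ContinuousOn.intervalIntegrable (by rwa [hu])
  have parts {p p' q q' : ℝ → ℝ} (hp : ContinuousOn p (Icc 0 L)) (hp' : ContinuousOn p' (Icc 0 L))
      (hq : ContinuousOn q (Icc 0 L)) (hq' : ContinuousOn q' (Icc 0 L))
      (dp : ∀ x ∈ Ioo 0 L, HasDerivAt p (p' x) x) (dq : ∀ x ∈ Ioo 0 L, HasDerivAt q (q' x) x) :
      ∫ x in (0 : ℝ)..L, p' x * q x =
        p L * q L - p 0 * q 0 - ∫ x in (0 : ℝ)..L, p x * q' x := by
    have := intervalIntegral.integral_mul_deriv_eq_deriv_mul_of_hasDerivAt (a := 0) (b := L)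
      (u := p) (v := q) (u' := p') (v' := q') (by rwa [hu]) (by rwa [hu])
      (by rwa [min_eq_left hL, max_eq_right hL]) (by rwa [min_eq_left hL, max_eq_right hL])
      (hI hp') (hI hq')
    linarith
  have hgc : ContinuousOn (fun x => α * g x + s * k x) (Icc 0 L) := by fun_prop
  have hkc : ContinuousOn (fun x => β * k x + m x + (s + 1) * n x) (Icc 0 L) := by fun_prop
  have expand {Y : ℝ → ℝ} (hY : ContinuousOn Y (Icc 0 L)) :
      ∫ x in (0 : ℝ)..L, Y x * (α * g x + s * k x) =
        α * (∫ x in (0 : ℝ)..L, Y x * g x) + s * ∫ x in (0 : ℝ)..L, Y x * k x := by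
    rw [← intervalIntegral.integral_const_mul, ← intervalIntegral.integral_const_mul,
      ← intervalIntegral.integral_add (hI (by fun_prop)) (hI (by fun_prop))]
    exact intervalIntegral.integral_congr fun x _ => by ring
  have e1 := parts hZ₁ hZ₂ hg hgc hZ₁Z₂ hg'
  have e2 := parts hZ hZ₁ hg hgc hZZ₁ hg'
  have e3 := parts hZ hZ₁ hk hkc hZZ₁ hk'
  have e4 : ∫ x in (0 : ℝ)..L, Z x * (β * k x + m x + (s + 1) * n x) =
      β * (∫ x in (0 : ℝ)..L, Z x * k x) + (∫ x in (0 : ℝ)..L, Z x * m x)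
        + (s + 1) * ∫ x in (0 : ℝ)..L, Z x * n x := by
    rw [← intervalIntegral.integral_const_mul, ← intervalIntegral.integral_const_mul,
      ← intervalIntegral.integral_add (hI (by fun_prop)) (hI (by fun_prop)),
      ← intervalIntegral.integral_add (hI (by fun_prop)) (hI (by fun_prop))]
    exact intervalIntegral.integral_congr fun x _ => by ring
  rw [expand hZ₁, h0, h1] at e1
  rw [expand hZ] at e2
  rw [e4, hk0, hkL] at e3
  rw [e1, e2, e3]
  ring

/-! ### Deterministic calculus of the tilted integrals `H` and `K`. -/

section Tilt

/-- `∫₀ʸ f(x) eˣ dx`. -/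
noncomputable def tiltPart (f : ℝ → ℝ) (y : ℝ) : ℝ := ∫ x in (0 : ℝ)..y, f x * Real.exp x

/-- `∫₀ʸ f(x) eˣ dx + eʸ ∫_y^L f(x) dx`, which is `∫₀ᴸ f(x) e^{min x y} dx` for `y ∈ [0, L]`. -/
noncomputable def tiltTotal (L : ℝ) (f : ℝ → ℝ) (y : ℝ) : ℝ :=
  tiltPart f y + Real.exp y * ∫ x in y..L, f x

variable {L : ℝ} {f : ℝ → ℝ}

lemma integral_mul_exp_min_part {y : ℝ} (hy : 0 ≤ y) :
    ∫ x in (0 : ℝ)..y, f x * Real.exp (min x y) = tiltPart f y := by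
  refine intervalIntegral.integral_congr fun x hx => ?_
  rw [uIcc_of_le hy] at hx
  simp only [min_eq_left hx.2]

lemma integral_mul_exp_min (hf : Continuous f) {y : ℝ} (hy : y ∈ Icc 0 L) :
    ∫ x in (0 : ℝ)..L, f x * Real.exp (min x y) = tiltTotal L f y := by
  have hc : Continuous fun x => f x * Real.exp (min x y) := by fun_prop
  rw [← intervalIntegral.integral_add_adjacent_intervals (hc.intervalIntegrable 0 y)
    (hc.intervalIntegrable y L), integral_mul_exp_min_part hy.1, tiltTotal,
    ← intervalIntegral.integral_const_mul]
  congr 1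
  refine intervalIntegral.integral_congr fun x hx => ?_
  rw [uIcc_of_le hy.2] at hx
  simp only [min_eq_right hx.1, mul_comm]

lemma hasDerivAt_tiltPart (hf : Continuous f) (y : ℝ) :
    HasDerivAt (tiltPart f) (f y * Real.exp y) y :=
  intervalIntegral.integral_hasDerivAt_right
    (Continuous.intervalIntegrable (by fun_prop) _ _)
    (Continuous.stronglyMeasurableAtFilter (by fun_prop) _ _) (by fun_prop)

/-- The contributions `± f(y) eʸ` of the moving endpoint cancel, so no value of `f` survives in
`H'`. -/
lemma hasDerivAt_tiltTotal (hf : Continuous f) (y : ℝ) :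
    HasDerivAt (tiltTotal L f) (tiltTotal L f y - tiltPart f y) y := by
  have h1 : HasDerivAt (fun y => ∫ x in y..L, f x) (-f y) y :=
    intervalIntegral.integral_hasDerivAt_left (hf.intervalIntegrable _ _)
      (hf.stronglyMeasurableAtFilter _ _) hf.continuousAt
  have h := (hasDerivAt_tiltPart hf y).add ((Real.hasDerivAt_exp y).mul h1)
  refine h.congr_deriv ?_
  simp only [tiltTotal]
  ring

lemma tiltPart_nonneg (hf0 : ∀ x, 0 < f x) {y : ℝ} (hy : 0 ≤ y) : 0 ≤ tiltPart f y :=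
  intervalIntegral.integral_nonneg hy fun x _ => mul_nonneg (hf0 x).le (Real.exp_pos x).le

lemma tiltPart_le_tiltTotal (hf0 : ∀ x, 0 < f x) {y : ℝ} (hy : y ≤ L) :
    tiltPart f y ≤ tiltTotal L f y :=
  le_add_of_nonneg_right (mul_nonneg (Real.exp_pos y).le
    (intervalIntegral.integral_nonneg hy fun x _ => (hf0 x).le))

/-- With `tiltTotal_le` this sandwiches `H` between `F` and `e^L F`, because `1 ≤ e^{min x y} ≤
e^L`. -/
lemma integral_le_tiltTotal (hf : Continuous f) (hf0 : ∀ x, 0 < f x) {y : ℝ} (hy : y ∈ Icc 0 L) :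
    ∫ x in (0 : ℝ)..L, f x ≤ tiltTotal L f y := by
  rw [← integral_mul_exp_min hf hy]
  refine intervalIntegral.integral_mono_on (hy.1.trans hy.2) (hf.intervalIntegrable _ _)
    (Continuous.intervalIntegrable (by fun_prop) _ _) fun x hx => ?_
  exact le_mul_of_one_le_right (hf0 x).le (Real.one_le_exp (le_min hx.1 hy.1))

lemma tiltTotal_le (hf : Continuous f) (hf0 : ∀ x, 0 < f x) {y : ℝ} (hy : y ∈ Icc 0 L) :
    tiltTotal L f y ≤ Real.exp L * ∫ x in (0 : ℝ)..L, f x := by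
  rw [← integral_mul_exp_min hf hy, ← intervalIntegral.integral_const_mul]
  refine intervalIntegral.integral_mono_on (hy.1.trans hy.2)
    (Continuous.intervalIntegrable (by fun_prop) _ _)
    (Continuous.intervalIntegrable (by fun_prop) _ _) fun x hx => ?_
  rw [mul_comm]
  exact mul_le_mul_of_nonneg_right (Real.exp_le_exp.2 (min_le_of_left_le hx.2)) (hf0 x).le

lemma integral_pos_of_continuous (hL : 0 < L) (hf : Continuous f) (hf0 : ∀ x, 0 < f x) :
    0 < ∫ x in (0 : ℝ)..L, f x :=
  intervalIntegral.intervalIntegral_pos_of_pos (hf.intervalIntegrable _ _) hf0 hL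

lemma tiltTotal_pos (hL : 0 < L) (hf : Continuous f) (hf0 : ∀ x, 0 < f x) {y : ℝ}
    (hy : y ∈ Icc 0 L) : 0 < tiltTotal L f y :=
  (integral_pos_of_continuous hL hf hf0).trans_le (integral_le_tiltTotal hf hf0 hy)

lemma tiltTotal_rpow_le (hL : 0 < L) (hf : Continuous f) (hf0 : ∀ x, 0 < f x) {y : ℝ}
    (hy : y ∈ Icc 0 L) (r : ℝ) :
    tiltTotal L f y ^ r ≤ Real.exp L ^ |r| * (∫ x in (0 : ℝ)..L, f x) ^ r := by
  have hF := integral_pos_of_continuous hL hf hf0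
  rcases le_total 0 r with hr | hr
  · rw [abs_of_nonneg hr, ← Real.mul_rpow (Real.exp_pos L).le hF.le]
    exact Real.rpow_le_rpow (tiltTotal_pos hL hf hf0 hy).le (tiltTotal_le hf hf0 hy) hr
  · refine (Real.rpow_le_rpow_of_nonpos hF (integral_le_tiltTotal hf hf0 hy) hr).trans ?_
    exact le_mul_of_one_le_left (Real.rpow_nonneg hF.le _)
      (Real.one_le_rpow (Real.one_le_exp hL.le) (abs_nonneg _))

lemma tiltPart_zero : tiltPart f 0 = 0 := by simp [tiltPart]

lemma tiltTotal_right : tiltTotal L f L = tiltPart f L := by simp [tiltTotal]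

lemma tiltTotal_zero : tiltTotal L f 0 = ∫ x in (0 : ℝ)..L, f x := by simp [tiltTotal, tiltPart]

/-- The tilted analogue `e^{αy} H(y)^{p-j} K(y)^j` of `X_y F^{p-j} F(y)^j`, where `H` and `K` are
the total and partial tilted integrals of `f`. -/
noncomputable def tiltMoment (L α p : ℝ) (j : ℕ) (f : ℝ → ℝ) (y : ℝ) : ℝ :=
  Real.exp (α * y) * (tiltTotal L f y ^ (p - j) * tiltPart f y ^ j)

/-- The tilted analogue of `f(y) X_y F^p`. -/
noncomputable def tiltSource (L α p : ℝ) (f : ℝ → ℝ) (y : ℝ) : ℝ :=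
  Real.exp (α * y) * (tiltTotal L f y ^ p * (f y * Real.exp y))

lemma hasDerivAt_tiltMoment_zero (hL : 0 < L) (hf : Continuous f) (hf0 : ∀ x, 0 < f x) (α p : ℝ)
    {y : ℝ} (hy : y ∈ Icc 0 L) :
    HasDerivAt (tiltMoment L α p 0 f)
      ((α + p) * tiltMoment L α p 0 f y + (-p) * tiltMoment L α p 1 f y) y := by
  have hH := (tiltTotal_pos hL hf hf0 hy)
  have h := (((hasDerivAt_id y).const_mul α).exp).mul
    ((hasDerivAt_tiltTotal (L := L) hf y).rpow_const (p := p) (Or.inl hH.ne'))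
  have heq : tiltMoment L α p 0 f =
      (fun y => Real.exp (α * id y)) * fun y => tiltTotal L f y ^ p := by
    ext y; simp [tiltMoment]
  rw [heq]
  refine h.congr_deriv ?_
  simp only [tiltMoment, Pi.mul_apply, id, Nat.cast_one, pow_one, Real.rpow_sub_one hH.ne']
  field_simp
  ring

/-- The value of `f` enters here through `K'`. The system is not continued to `g_2`, which is only
ever integrated against `Z`. -/
lemma hasDerivAt_tiltMoment_one (hL : 0 < L) (hf : Continuous f) (hf0 : ∀ x, 0 < f x) (α p : ℝ)
    {y : ℝ} (hy : y ∈ Icc 0 L) :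
    HasDerivAt (tiltMoment L α p 1 f)
      ((α + p - 1) * tiltMoment L α p 1 f y + tiltSource L α (p - 1) f y
        + (-p + 1) * tiltMoment L α p 2 f y) y := by
  have hH := (tiltTotal_pos hL hf hf0 hy)
  have h := (((hasDerivAt_id y).const_mul α).exp).mul
    (((hasDerivAt_tiltTotal (L := L) hf y).rpow_const (p := p - 1) (Or.inl hH.ne')).mul
      (hasDerivAt_tiltPart hf y))
  have heq : tiltMoment L α p 1 f =
      (fun y => Real.exp (α * id y)) * ((fun y => tiltTotal L f y ^ (p - 1)) * tiltPart f) := by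
    ext y; simp [tiltMoment]
  rw [heq]
  refine h.congr_deriv ?_
  have h2 : p - (2 : ℕ) = p - 1 - 1 := by push_cast; ring
  simp only [tiltMoment, tiltSource, Pi.mul_apply, id, h2, Real.rpow_sub_one hH.ne']
  field_simp
  ring

lemma continuous_tiltPart (hf : Continuous f) : Continuous (tiltPart f) :=
  continuous_iff_continuousAt.2 fun y => (hasDerivAt_tiltPart hf y).continuousAt

lemma continuous_tiltTotal (hf : Continuous f) : Continuous (tiltTotal L f) :=
  continuous_iff_continuousAt.2 fun y => (hasDerivAt_tiltTotal hf y).continuousAt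

lemma continuousOn_tiltTotal_rpow (hL : 0 < L) (hf : Continuous f) (hf0 : ∀ x, 0 < f x) (p : ℝ) :
    ContinuousOn (fun y => tiltTotal L f y ^ p) (Icc 0 L) :=
  (continuous_tiltTotal hf).continuousOn.rpow_const fun _ hy =>
    Or.inl (tiltTotal_pos hL hf hf0 hy).ne'

lemma continuousOn_tiltMoment (hL : 0 < L) (hf : Continuous f) (hf0 : ∀ x, 0 < f x) (α p : ℝ)
    (j : ℕ) : ContinuousOn (tiltMoment L α p j f) (Icc 0 L) := by
  have h1 := continuousOn_tiltTotal_rpow hL hf hf0 (p - j)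
  have h2 := (continuous_tiltPart hf).continuousOn (s := Icc 0 L)
  unfold tiltMoment
  fun_prop

lemma continuousOn_tiltSource (hL : 0 < L) (hf : Continuous f) (hf0 : ∀ x, 0 < f x) (α p : ℝ) :
    ContinuousOn (tiltSource L α p f) (Icc 0 L) := by
  have h1 := continuousOn_tiltTotal_rpow hL hf hf0 p
  have h2 := hf.continuousOn (s := Icc 0 L)
  unfold tiltSource
  fun_prop

lemma tiltMoment_nonneg (hL : 0 < L) (hf : Continuous f) (hf0 : ∀ x, 0 < f x) (α p : ℝ)
    (j : ℕ) {y : ℝ} (hy : y ∈ Icc 0 L) : 0 ≤ tiltMoment L α p j f y := by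
  have := tiltTotal_pos hL hf hf0 hy
  have := tiltPart_nonneg hf0 hy.1
  unfold tiltMoment
  positivity

lemma tiltSource_nonneg (hL : 0 < L) (hf : Continuous f) (hf0 : ∀ x, 0 < f x) (α p : ℝ)
    {y : ℝ} (hy : y ∈ Icc 0 L) : 0 ≤ tiltSource L α p f y := by
  have := tiltTotal_pos hL hf hf0 hy
  have := hf0 y
  unfold tiltSource
  positivity

lemma exp_mul_le_exp_abs_mul {α y : ℝ} (hy : y ∈ Icc 0 L) :
    Real.exp (α * y) ≤ Real.exp (|α| * L) := by
  rw [Real.exp_le_exp]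
  exact (mul_le_mul_of_nonneg_right (le_abs_self α) hy.1).trans
    (mul_le_mul_of_nonneg_left hy.2 (abs_nonneg α))

/-- The ratio `(K/H)^j` is at most `1`, so the bound does not depend on `j`. -/
lemma tiltMoment_le (hL : 0 < L) (hf : Continuous f) (hf0 : ∀ x, 0 < f x) (α p : ℝ)
    (j : ℕ) {y : ℝ} (hy : y ∈ Icc 0 L) :
    tiltMoment L α p j f y ≤
      Real.exp (|α| * L) * (Real.exp L ^ |p| * (∫ x in (0 : ℝ)..L, f x) ^ p) := by
  have hH := tiltTotal_pos hL hf hf0 hy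
  have hK := tiltPart_nonneg hf0 hy.1
  refine mul_le_mul (exp_mul_le_exp_abs_mul hy) ?_ (by positivity) (Real.exp_pos _).le
  refine le_trans ?_ (tiltTotal_rpow_le hL hf hf0 hy p)
  rw [Real.rpow_sub hH, Real.rpow_natCast, div_mul_eq_mul_div, div_le_iff₀ (by positivity)]
  exact mul_le_mul_of_nonneg_left (pow_le_pow_left₀ hK (tiltPart_le_tiltTotal hf0 hy.2) j)
    (Real.rpow_nonneg hH.le _)

/-- The factor `f y` stays in the bound; integrating it over `y` later supplies one more power of
`F`. -/
lemma tiltSource_le (hL : 0 < L) (hf : Continuous f) (hf0 : ∀ x, 0 < f x) (α p : ℝ)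
    {y : ℝ} (hy : y ∈ Icc 0 L) :
    tiltSource L α p f y ≤
      Real.exp (|α| * L) * (Real.exp L ^ |p| * (∫ x in (0 : ℝ)..L, f x) ^ p * Real.exp L) * f y := by
  have hH := tiltTotal_pos hL hf hf0 hy
  have hy0 := hf0 y
  have hF := integral_pos_of_continuous hL hf hf0
  rw [tiltSource, mul_assoc]
  refine mul_le_mul (exp_mul_le_exp_abs_mul hy) ?_ (by positivity) (Real.exp_pos _).le
  rw [mul_assoc, mul_comm (Real.exp L) (f y)]
  refine mul_le_mul (tiltTotal_rpow_le hL hf hf0 hy p) ?_ (by positivity) (by positivity)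
  exact mul_le_mul_of_nonneg_left (Real.exp_le_exp.2 hy.2) hy0.le

end Tilt

/-! ### Exchanging expectation with integration over `y`. -/

section Swap

variable {Ω : Type*} [MeasurableSpace Ω] {P : Measure Ω} {L : ℝ}

lemma ae_prod_fst_mem_Icc :
    ∀ᵐ q ∂((volume.restrict (Ioc 0 L)).prod P), q.1 ∈ Icc 0 L :=
  Measure.quasiMeasurePreserving_fst.ae
    ((ae_restrict_mem measurableSet_Ioc).mono fun _ hy => Ioc_subset_Icc_self hy)

lemma integrable_of_lintegral_eq {X Y : Ω → ℝ} (hX : Measurable X) (hX0 : ∀ ω, 0 ≤ X ω)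
    (hY0 : ∀ ω, 0 ≤ Y ω)
    (hXY : ∫⁻ ω, ENNReal.ofReal (X ω) ∂P = ∫⁻ ω, ENNReal.ofReal (Y ω) ∂P) (hY : Integrable Y P) :
    Integrable X P := by
  refine ⟨hX.aestronglyMeasurable, ?_⟩
  rw [hasFiniteIntegral_iff_ofReal (Eventually.of_forall hX0), hXY]
  exact (hasFiniteIntegral_iff_ofReal (Eventually.of_forall hY0)).1 hY.2

lemma integral_eq_of_lintegral_eq {X Y : Ω → ℝ} (hX : Measurable X) (hX0 : ∀ ω, 0 ≤ X ω)
    (hY : Measurable Y) (hY0 : ∀ ω, 0 ≤ Y ω)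
    (hXY : ∫⁻ ω, ENNReal.ofReal (X ω) ∂P = ∫⁻ ω, ENNReal.ofReal (Y ω) ∂P) :
    ∫ ω, X ω ∂P = ∫ ω, Y ω ∂P := by
  rw [integral_eq_lintegral_of_nonneg_ae (Eventually.of_forall hX0) hX.aestronglyMeasurable,
    integral_eq_lintegral_of_nonneg_ae (Eventually.of_forall hY0) hY.aestronglyMeasurable, hXY]

variable [IsProbabilityMeasure P]

/-- If `A y` and `A' y` have the same integral for every `y`, so do their weighted integrals over
`y ∈ [0, L]`. -/
lemma integral_intervalIntegral_eq {A A' : ℝ → Ω → ℝ} {h : ℝ → ℝ} (hL : 0 ≤ L)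
    (hh : ContinuousOn h (Icc 0 L)) (hA : Measurable (Function.uncurry A))
    (hA' : Measurable (Function.uncurry A')) (hA0 : ∀ y ∈ Icc 0 L, ∀ ω, 0 ≤ A y ω)
    (hA'0 : ∀ y ∈ Icc 0 L, ∀ ω, 0 ≤ A' y ω)
    (heq : ∀ y ∈ Icc 0 L,
      ∫⁻ ω, ENNReal.ofReal (A y ω) ∂P = ∫⁻ ω, ENNReal.ofReal (A' y ω) ∂P)
    (hint : Integrable (Function.uncurry A') ((volume.restrict (Ioc 0 L)).prod P)) :
    Integrable (fun ω => ∫ y in (0 : ℝ)..L, h y * A y ω) P ∧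
    Integrable (fun ω => ∫ y in (0 : ℝ)..L, h y * A' y ω) P ∧
    ∫ ω, (∫ y in (0 : ℝ)..L, h y * A y ω) ∂P = ∫ ω, (∫ y in (0 : ℝ)..L, h y * A' y ω) ∂P := by
  have hmem : ∀ᵐ y ∂(volume.restrict (Ioc 0 L)), y ∈ Icc (0 : ℝ) L :=
    (ae_restrict_mem measurableSet_Ioc).mono fun _ hy => Ioc_subset_Icc_self hy
  -- By nonnegativity, equality of the lower integrals at each `y` carries integrability over from
  -- `A'` to `A`.
  have hAint : Integrable (Function.uncurry A) ((volume.restrict (Ioc 0 L)).prod P) := by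
    refine ⟨hA.aestronglyMeasurable, ?_⟩
    rw [hasFiniteIntegral_iff_ofReal (f := Function.uncurry A)
      (ae_prod_fst_mem_Icc.mono fun q hq => hA0 q.1 hq q.2), lintegral_prod _ (by fun_prop)]
    have := (hasFiniteIntegral_iff_ofReal (f := Function.uncurry A')
      (ae_prod_fst_mem_Icc.mono fun q hq => hA'0 q.1 hq q.2)).1 hint.2
    rw [lintegral_prod _ (by fun_prop)] at this
    refine lt_of_eq_of_lt (lintegral_congr_ae ?_) this
    exact hmem.mono fun y hy => heq y hy
  obtain ⟨C, hC⟩ := isCompact_Icc.exists_bound_of_continuousOn hh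
  have hhm : AEStronglyMeasurable h (volume.restrict (Ioc 0 L)) :=
    (hh.mono Ioc_subset_Icc_self).aestronglyMeasurable measurableSet_Ioc
  have hmul {A : ℝ → Ω → ℝ}
      (hAint : Integrable (Function.uncurry A) ((volume.restrict (Ioc 0 L)).prod P)) :
      Integrable (Function.uncurry fun y ω => h y * A y ω)
        ((volume.restrict (Ioc 0 L)).prod P) :=
    hAint.bdd_mul hhm.comp_fst (ae_prod_fst_mem_Icc.mono fun q hq => hC q.1 hq)
  simp only [intervalIntegral.integral_of_le hL]
  refine ⟨(hmul hAint).integral_prod_right, (hmul hint).integral_prod_right, ?_⟩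
  rw [← integral_integral_swap (hmul hAint), ← integral_integral_swap (hmul hint)]
  refine integral_congr_ae (hmem.mono fun y hy => ?_)
  simp only [integral_const_mul]
  rw [integral_eq_of_lintegral_eq (X := A y) (Y := A' y) (hA.comp measurable_prodMk_left) (hA0 y hy)
    (hA'.comp measurable_prodMk_left) (hA'0 y hy) (heq y hy)]

end Swap

/-! ### Path functionals, their tilted counterparts, and integrability. -/

section PathFunctionals

variable {Ω : Type*} {L : ℝ}

/-- The path `x ↦ e^{d(x) + W x}`, with `W` extended to the line by constants. -/
noncomputable def expPath (hL : 0 ≤ L) (d : ℝ → ℝ) (W : Icc (0 : ℝ) L → Ω → ℝ) (ω : Ω) (x : ℝ) : ℝ :=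
  Real.exp (d x + W (projIcc 0 L hL x) ω)

/-- `e^{vy + W y} F(L)^{p-j} F(y)^j`, where `F` is the primitive of the exponential path. -/
noncomputable def pathMoment (hL : 0 ≤ L) (d : ℝ → ℝ) (W : Icc (0 : ℝ) L → Ω → ℝ) (v p : ℝ)
    (j : ℕ) (y : ℝ) (ω : Ω) : ℝ :=
  expPath hL (fun x => v * x) W ω y *
    ((∫ x in (0 : ℝ)..L, expPath hL d W ω x) ^ (p - j) *
      (∫ x in (0 : ℝ)..y, expPath hL d W ω x) ^ j)

/-- `e^{vy + W y} F(L)^p F'(y)`, where `F` is the primitive of the exponential path. -/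
noncomputable def pathSource (hL : 0 ≤ L) (d : ℝ → ℝ) (W : Icc (0 : ℝ) L → Ω → ℝ) (v p : ℝ)
    (y : ℝ) (ω : Ω) : ℝ :=
  expPath hL (fun x => v * x) W ω y *
    ((∫ x in (0 : ℝ)..L, expPath hL d W ω x) ^ p * expPath hL d W ω y)

lemma expPath_pos (hL : 0 ≤ L) (d : ℝ → ℝ) (W : Icc (0 : ℝ) L → Ω → ℝ) (ω : Ω) (x : ℝ) :
    0 < expPath hL d W ω x := Real.exp_pos _

lemma pathMoment_nonneg (hL : 0 ≤ L) (d : ℝ → ℝ) (W : Icc (0 : ℝ) L → Ω → ℝ) (v p : ℝ) (j : ℕ) {y : ℝ}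
    (hy : y ∈ Icc 0 L) (ω : Ω) : 0 ≤ pathMoment hL d W v p j y ω := by
  have h1 := (expPath_pos hL (fun x => v * x) W ω y).le
  have h2 : 0 ≤ ∫ x in (0 : ℝ)..L, expPath hL d W ω x :=
    intervalIntegral.integral_nonneg hL fun x _ => (expPath_pos hL d W ω x).le
  have h3 : 0 ≤ ∫ x in (0 : ℝ)..y, expPath hL d W ω x :=
    intervalIntegral.integral_nonneg hy.1 fun x _ => (expPath_pos hL d W ω x).le
  unfold pathMoment
  positivity

lemma pathSource_nonneg (hL : 0 ≤ L) (d : ℝ → ℝ) (W : Icc (0 : ℝ) L → Ω → ℝ) (v p y : ℝ) (ω : Ω) :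
    0 ≤ pathSource hL d W v p y ω := by
  have h1 := (expPath_pos hL (fun x => v * x) W ω y).le
  have h2 : 0 ≤ ∫ x in (0 : ℝ)..L, expPath hL d W ω x :=
    intervalIntegral.integral_nonneg hL fun x _ => (expPath_pos hL d W ω x).le
  have h3 := (expPath_pos hL d W ω y).le
  unfold pathSource
  positivity

variable [MeasurableSpace Ω] {P : Measure Ω} {W : Icc (0 : ℝ) L → Ω → ℝ} {d : ℝ → ℝ}

lemma IsRegularBrownian.continuous_expPath (hW : IsRegularBrownian L W P) (hL : 0 ≤ L)
    (hd : Continuous d) (ω : Ω) : Continuous (expPath hL d W ω) :=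
  (hd.add (hW.continuous_projIcc hL ω)).rexp

lemma IsRegularBrownian.measurable_expPath (hW : IsRegularBrownian L W P) (hL : 0 ≤ L)
    (x : ℝ) : Measurable fun ω => expPath hL d W ω x := by
  have := hW.measurable (projIcc 0 L hL x)
  unfold expPath
  fun_prop

lemma IsRegularBrownian.measurable_uncurry_expPath (hW : IsRegularBrownian L W P) (hL : 0 ≤ L)
    (hd : Continuous d) : Measurable fun q : ℝ × Ω => expPath hL d W q.2 q.1 :=
  measurable_uncurry_of_continuous_of_measurable (u := fun x ω => expPath hL d W ω x)
    (hW.continuous_expPath hL hd) (hW.measurable_expPath hL)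

lemma IsRegularBrownian.measurable_integral_expPath (hW : IsRegularBrownian L W P) (hL : 0 ≤ L)
    (hd : Continuous d) (y : ℝ) : Measurable fun ω => ∫ x in (0 : ℝ)..y, expPath hL d W ω x :=
  measurable_intervalIntegral_of_continuous (hW.continuous_expPath hL hd)
    (hW.measurable_expPath hL) 0 y

lemma IsRegularBrownian.measurable_pathMoment (hW : IsRegularBrownian L W P) (hL : 0 ≤ L)
    (hd : Continuous d) (v p : ℝ) (j : ℕ) :
    Measurable (Function.uncurry (pathMoment hL d W v p j)) := by
  have h1 := hW.measurable_uncurry_expPath hL (d := fun x => v * x) (by fun_prop)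
  have h2 : Measurable fun q : ℝ × Ω => ∫ x in (0 : ℝ)..L, expPath hL d W q.2 x :=
    (hW.measurable_integral_expPath hL hd L).comp measurable_snd
  have h3 : Measurable fun q : ℝ × Ω => ∫ x in (0 : ℝ)..q.1, expPath hL d W q.2 x :=
    measurable_uncurry_of_continuous_of_measurable
      (u := fun y ω => ∫ x in (0 : ℝ)..y, expPath hL d W ω x)
      (fun ω => intervalIntegral.continuous_primitive
        (fun a b => (hW.continuous_expPath hL hd ω).intervalIntegrable a b) 0)
      (hW.measurable_integral_expPath hL hd)
  exact h1.mul ((h2.pow_const _).mul (h3.pow_const _))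

lemma IsRegularBrownian.measurable_pathSource (hW : IsRegularBrownian L W P) (hL : 0 ≤ L)
    (hd : Continuous d) (v p : ℝ) : Measurable (Function.uncurry (pathSource hL d W v p)) := by
  have h1 := hW.measurable_uncurry_expPath hL (d := fun x => v * x) (by fun_prop)
  have h2 : Measurable fun q : ℝ × Ω => ∫ x in (0 : ℝ)..L, expPath hL d W q.2 x :=
    (hW.measurable_integral_expPath hL hd L).comp measurable_snd
  exact h1.mul ((h2.pow_const _).mul (hW.measurable_uncurry_expPath hL hd))

lemma IsRegularBrownian.measurable_tilt (hW : IsRegularBrownian L W P) (hL : 0 ≤ L)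
    (hd : Continuous d) :
    (Measurable fun q : ℝ × Ω => tiltPart (expPath hL d W q.2) q.1) ∧
      Measurable fun q : ℝ × Ω => tiltTotal L (expPath hL d W q.2) q.1 := by
  have hf := hW.continuous_expPath hL hd
  have hm (y : ℝ) : Measurable fun ω => tiltPart (expPath hL d W ω) y :=
    measurable_intervalIntegral_of_continuous (φ := fun x ω => expPath hL d W ω x * Real.exp x)
      (fun ω => (hf ω).mul Real.continuous_exp)
      (fun x => (hW.measurable_expPath hL x).mul_const _) 0 y
  refine ⟨measurable_uncurry_of_continuous_of_measurable
    (u := fun y ω => tiltPart (expPath hL d W ω) y) (fun ω => continuous_tiltPart (hf ω)) hm,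
    measurable_uncurry_of_continuous_of_measurable
    (u := fun y ω => tiltTotal L (expPath hL d W ω) y) (fun ω => continuous_tiltTotal (hf ω))
    fun y => (hm y).add (measurable_const.mul ?_)⟩
  exact measurable_intervalIntegral_of_continuous hf (hW.measurable_expPath hL) y L

lemma IsRegularBrownian.measurable_tiltMoment (hW : IsRegularBrownian L W P) (hL : 0 ≤ L)
    (hd : Continuous d) (α p : ℝ) (j : ℕ) :
    Measurable (Function.uncurry fun y ω => tiltMoment L α p j (expPath hL d W ω) y) := by
  obtain ⟨h1, h2⟩ := hW.measurable_tilt hL hd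
  exact (Real.measurable_exp.comp (measurable_fst.const_mul α)).mul
    ((h2.pow_const _).mul (h1.pow_const _))

lemma IsRegularBrownian.measurable_tiltSource (hW : IsRegularBrownian L W P) (hL : 0 ≤ L)
    (hd : Continuous d) (α p : ℝ) :
    Measurable (Function.uncurry fun y ω => tiltSource L α p (expPath hL d W ω) y) := by
  obtain ⟨-, h2⟩ := hW.measurable_tilt hL hd
  exact (Real.measurable_exp.comp (measurable_fst.const_mul α)).mul
    ((h2.pow_const _).mul ((hW.measurable_uncurry_expPath hL hd).mul
      (Real.measurable_exp.comp measurable_fst)))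

variable [IsProbabilityMeasure P]

/-- The Cameron–Martin formula rewritten with the tilted integrals. -/
lemma IsRegularBrownian.lintegral_expPath_mul (hW : IsRegularBrownian L W P) (hL : 0 ≤ L)
    (hd : Continuous d) (v : ℝ) {y : ℝ} (hy : y ∈ Icc 0 L) {G : ℝ × ℝ × ℝ → ℝ}
    (hG : Measurable G) :
    ∫⁻ ω, ENNReal.ofReal (expPath hL (fun x => v * x) W ω y *
        G (expPath hL d W ω y, ∫ x in (0 : ℝ)..L, expPath hL d W ω x,
          ∫ x in (0 : ℝ)..y, expPath hL d W ω x)) ∂P =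
      ∫⁻ ω, ENNReal.ofReal (Real.exp ((v + 1 / 2) * y) *
        G (expPath hL d W ω y * Real.exp y, tiltTotal L (expPath hL d W ω) y,
          tiltPart (expPath hL d W ω) y)) ∂P := by
  have key := hW.lintegral_exp_mul hL ⟨y, hy⟩ hd
    -- The value of the exponential path at `y` is recovered from `W y` as `exp (d y + W y)`; the
    -- shift by `y` multiplies it by `eʸ`.
    (G := fun q => ENNReal.ofReal (Real.exp (v * y) * G (Real.exp (d y + q.1), q.2)))
    (by fun_prop)
  rw [← lintegral_const_mul' _ _ ENNReal.ofReal_ne_top] at key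
  convert key using 1
  · refine lintegral_congr fun ω => ?_
    rw [← ENNReal.ofReal_mul (Real.exp_pos _).le, ← mul_assoc, ← Real.exp_add]
    simp only [expPath, projIcc_of_mem hL hy, add_comm (v * y)]
  · refine lintegral_congr fun ω => ?_
    have h1 := integral_mul_exp_min (hW.continuous_expPath hL hd ω) hy
    have h2 := integral_mul_exp_min_part (f := expPath hL d W ω) hy.1
    rw [← ENNReal.ofReal_mul (Real.exp_pos _).le, ← mul_assoc, ← Real.exp_add, ← h1, ← h2]
    simp only [expPath, projIcc_of_mem hL hy, ← Real.exp_add, ← add_assoc]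
    congr 4
    ring

lemma IsRegularBrownian.lintegral_pathMoment (hW : IsRegularBrownian L W P) (hL : 0 ≤ L)
    (hd : Continuous d) (v p : ℝ) (j : ℕ) {y : ℝ} (hy : y ∈ Icc 0 L) :
    ∫⁻ ω, ENNReal.ofReal (pathMoment hL d W v p j y ω) ∂P =
      ∫⁻ ω, ENNReal.ofReal (tiltMoment L (v + 1 / 2) p j (expPath hL d W ω) y) ∂P :=
  hW.lintegral_expPath_mul hL hd v hy (G := fun q => q.2.1 ^ (p - j) * q.2.2 ^ j) (by fun_prop)

lemma IsRegularBrownian.lintegral_pathSource (hW : IsRegularBrownian L W P) (hL : 0 ≤ L)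
    (hd : Continuous d) (v p : ℝ) {y : ℝ} (hy : y ∈ Icc 0 L) :
    ∫⁻ ω, ENNReal.ofReal (pathSource hL d W v p y ω) ∂P =
      ∫⁻ ω, ENNReal.ofReal (tiltSource L (v + 1 / 2) p (expPath hL d W ω) y) ∂P :=
  hW.lintegral_expPath_mul hL hd v hy (G := fun q => q.2.1 ^ p * q.1) (by fun_prop)

lemma IsRegularBrownian.integrable_tiltMoment (hW : IsRegularBrownian L W P) (hL : 0 < L)
    (hd : Continuous d) (α p : ℝ) (j : ℕ) :
    Integrable (Function.uncurry fun y ω => tiltMoment L α p j (expPath hL.le d W ω) y)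
      ((volume.restrict (Ioc 0 L)).prod P) := by
  refine Integrable.mono' (((((hW.integrable_rpow hL hd p).const_mul (Real.exp L ^ |p|)).const_mul
    (Real.exp (|α| * L))).comp_snd (volume.restrict (Ioc 0 L))))
    (hW.measurable_tiltMoment hL.le hd α p j).aestronglyMeasurable
    (ae_prod_fst_mem_Icc.mono fun q hq => ?_)
  have hf := hW.continuous_expPath hL.le hd q.2
  have hf0 := expPath_pos hL.le d W q.2
  rw [Function.uncurry, Real.norm_of_nonneg (tiltMoment_nonneg hL hf hf0 α p j hq)]
  exact tiltMoment_le hL hf hf0 α p j hq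

/-- The dominating function is a constant times `F^p f(y)`, whose integral over `y` is `F^{p+1}`. -/
lemma IsRegularBrownian.integrable_tiltSource (hW : IsRegularBrownian L W P) (hL : 0 < L)
    (hd : Continuous d) (α p : ℝ) :
    Integrable (Function.uncurry fun y ω => tiltSource L α p (expPath hL.le d W ω) y)
      ((volume.restrict (Ioc 0 L)).prod P) := by
  have hf := hW.continuous_expPath hL.le hd
  have hf0 := expPath_pos hL.le d W
  have hF (ω : Ω) := integral_pos_of_continuous hL (hf ω) (hf0 ω)
  have hm : Measurable fun q : ℝ × Ω =>
      (∫ x in (0 : ℝ)..L, expPath hL.le d W q.2 x) ^ p * expPath hL.le d W q.2 q.1 :=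
    (((hW.measurable_integral_expPath hL.le hd L).comp measurable_snd).pow_const p).mul
      (hW.measurable_uncurry_expPath hL.le hd)
  have hint : Integrable (fun q : ℝ × Ω =>
      (∫ x in (0 : ℝ)..L, expPath hL.le d W q.2 x) ^ p * expPath hL.le d W q.2 q.1)
      ((volume.restrict (Ioc 0 L)).prod P) := by
    refine (integrable_prod_iff' hm.aestronglyMeasurable).2
      ⟨Eventually.of_forall fun ω => ?_, ?_⟩
    · have h : Integrable (expPath hL.le d W ω) (volume.restrict (Ioc 0 L)) :=
        (hf ω).integrableOn_Icc.mono_set Ioc_subset_Icc_self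
      exact h.const_mul ((∫ x in (0 : ℝ)..L, expPath hL.le d W ω x) ^ p)
    · refine (hW.integrable_rpow hL hd (p + 1)).congr (Eventually.of_forall fun ω => ?_)
      have hn (x : ℝ) : ‖(∫ x in (0 : ℝ)..L, expPath hL.le d W ω x) ^ p * expPath hL.le d W ω x‖ =
          (∫ x in (0 : ℝ)..L, expPath hL.le d W ω x) ^ p * expPath hL.le d W ω x :=
        Real.norm_of_nonneg (mul_nonneg (Real.rpow_nonneg (hF ω).le _) (hf0 ω x).le)
      simp only [hn, integral_const_mul]
      rw [← intervalIntegral.integral_of_le hL.le, ← Real.rpow_add_one (hF ω).ne']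
      rfl
  refine Integrable.mono' (hint.const_mul
    (Real.exp (|α| * L) * (Real.exp L ^ |p| * Real.exp L)))
    (hW.measurable_tiltSource hL.le hd α p).aestronglyMeasurable
    (ae_prod_fst_mem_Icc.mono fun q hq => ?_)
  rw [Function.uncurry, Real.norm_of_nonneg (tiltSource_nonneg hL (hf q.2) (hf0 q.2) α p hq)]
  refine (tiltSource_le hL (hf q.2) (hf0 q.2) α p hq).trans_eq ?_
  ring

end PathFunctionals

/-! ### Assembling the identity for the regular version. -/

lemma integral_mul_primitive_pow {f : ℝ → ℝ} (hf : Continuous f) (L : ℝ) (j : ℕ) :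
    ∫ y in (0 : ℝ)..L, f y * (∫ x in (0 : ℝ)..y, f x) ^ j =
      (∫ x in (0 : ℝ)..L, f x) ^ (j + 1) / (j + 1) := by
  have hF (y : ℝ) : HasDerivAt (fun y => ∫ x in (0 : ℝ)..y, f x) (f y) y :=
    intervalIntegral.integral_hasDerivAt_right (hf.intervalIntegrable _ _)
      (hf.stronglyMeasurableAtFilter _ _) hf.continuousAt
  have hFc : Continuous fun y => ∫ x in (0 : ℝ)..y, f x :=
    continuous_iff_continuousAt.2 fun y => (hF y).continuousAt
  have hd (y : ℝ) : HasDerivAt (fun y => (∫ x in (0 : ℝ)..y, f x) ^ (j + 1) / (j + 1))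
      (f y * (∫ x in (0 : ℝ)..y, f x) ^ j) y := by
    refine (((hF y).pow (j + 1)).div_const ((j : ℝ) + 1)).congr_deriv ?_
    push_cast
    field_simp
  rw [intervalIntegral.integral_eq_sub_of_hasDerivAt (fun y _ => hd y)
    (Continuous.intervalIntegrable (by fun_prop) _ _)]
  simp

lemma integral_linear_combination {Ω : Type*} [MeasurableSpace Ω] {P : Measure Ω}
    {a b c e f q : Ω → ℝ} (ha : Integrable a P) (hb : Integrable b P) (hc : Integrable c P)
    (he : Integrable e P) (hf : Integrable f P) (hq : Integrable q P)
    (r s z z' r' s' t w : ℝ) :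
    ∫ ω, r * (z * a ω - z' * b ω - r' * c ω - s' * e ω)
        - s * (z * a ω - t * e ω - f ω - w * q ω) ∂P =
      r * (z * (∫ ω, a ω ∂P) - z' * (∫ ω, b ω ∂P) - r' * (∫ ω, c ω ∂P) - s' * ∫ ω, e ω ∂P)
        - s * (z * (∫ ω, a ω ∂P) - t * (∫ ω, e ω ∂P) - (∫ ω, f ω ∂P) - w * ∫ ω, q ω ∂P) := by
  rw [integral_sub (by fun_prop) (by fun_prop), integral_const_mul, integral_const_mul,
    integral_sub (by fun_prop) (by fun_prop), integral_sub (by fun_prop) (by fun_prop),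
    integral_sub (by fun_prop) (by fun_prop), integral_sub (by fun_prop) (by fun_prop),
    integral_sub (by fun_prop) (by fun_prop), integral_sub (by fun_prop) (by fun_prop)]
  simp only [integral_const_mul]

section Identity

variable {Ω : Type*} [MeasurableSpace Ω] {P : Measure Ω} {L : ℝ} {W : Icc (0 : ℝ) L → Ω → ℝ}
  {d : ℝ → ℝ}

/-- The weight `Z` turns `e^{vy + W y}` into the derivative of the primitive, so the integrand is an
exact derivative up to the constant factor `F^{p-j}`. -/
lemma IsRegularBrownian.integral_mul_pathMoment (hW : IsRegularBrownian L W P) (hL : 0 < L)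
    (hd : Continuous d) {Z : ℝ → ℝ} {v : ℝ} (hZ : ∀ y ∈ Icc 0 L, ∀ ω,
      Z y * expPath hL.le (fun x => v * x) W ω y = expPath hL.le d W ω y) (p : ℝ) (j : ℕ) (ω : Ω) :
    ∫ y in (0 : ℝ)..L, Z y * pathMoment hL.le d W v p j y ω =
      (∫ x in (0 : ℝ)..L, expPath hL.le d W ω x) ^ (p + 1) / (j + 1) := by
  have hf := hW.continuous_expPath hL.le hd ω
  have hF := integral_pos_of_continuous hL hf (expPath_pos hL.le d W ω)
  have h : ∫ y in (0 : ℝ)..L, Z y * pathMoment hL.le d W v p j y ω =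
      ∫ y in (0 : ℝ)..L, (∫ x in (0 : ℝ)..L, expPath hL.le d W ω x) ^ (p - j) *
        (expPath hL.le d W ω y * (∫ x in (0 : ℝ)..y, expPath hL.le d W ω x) ^ j) := by
    refine intervalIntegral.integral_congr fun y hy => ?_
    rw [uIcc_of_le hL.le] at hy
    simp only [pathMoment]
    rw [← hZ y hy ω]
    ring
  rw [h, intervalIntegral.integral_const_mul, integral_mul_primitive_pow hf, ← mul_div_assoc,
    ← Real.rpow_natCast, ← Real.rpow_add hF]
  push_cast
  ring_nf

variable [IsProbabilityMeasure P]

/-- The moment identity for exponential functionals of a Brownian motion with measurable coordinates and continuous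
paths, together with the integrability of the random variables involved. -/
theorem IsRegularBrownian.integral_identity (hW : IsRegularBrownian L W P) (hL : 0 < L)
    {Z Z₁ Z₂ : ℝ → ℝ} (hZ : ContinuousOn Z (Icc 0 L)) (hZ₁ : ContinuousOn Z₁ (Icc 0 L))
    (hZ₂ : ContinuousOn Z₂ (Icc 0 L)) (hZZ₁ : ∀ x ∈ Ioo 0 L, HasDerivAt Z (Z₁ x) x)
    (hZ₁Z₂ : ∀ x ∈ Ioo 0 L, HasDerivAt Z₁ (Z₂ x) x) (h0 : Z₁ 0 = 0) (h1 : Z₁ L = 0)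
    (hZpos : ∀ x ∈ Icc 0 L, 0 < Z x) (u v : ℝ) (X : Ω → ℝ → ℝ)
    (hX : ∀ ω, ∀ y ∈ Icc 0 L, X ω y = expPath hL.le (fun x => v * x) W ω y)
    (F : Ω → ℝ) (hF : ∀ ω, F ω = ∫ y in (0 : ℝ)..L, Z y * X ω y) :
    Integrable (fun ω => F ω ^ (-u - v - 1) * ∫ y in (0 : ℝ)..L, Z₂ y * X ω y) P ∧
    Integrable (fun ω => F ω ^ (-u - v - 1) * X ω L) P ∧
    Integrable (fun ω => F ω ^ (-u - v - 1)) P ∧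
    Integrable (fun ω => F ω ^ (-u - v)) P ∧
    Integrable (fun ω => F ω ^ (-u - v - 2) * ∫ y in (0 : ℝ)..L, Z y ^ 2 * X ω y ^ 2) P ∧
    ∫ ω, F ω ^ (-u - v - 1) * (∫ y in (0 : ℝ)..L, Z₂ y * X ω y) ∂P =
      -(v + 1 / 2) * Z L * (∫ ω, F ω ^ (-u - v - 1) * X ω L ∂P)
        - (u + 1 / 2) * Z 0 * (∫ ω, F ω ^ (-u - v - 1) ∂P)
        + (1 / 3 * u ^ 2 + 1 / 3 * v ^ 2 - 1 / 3 * u * v - 1 / 12) * (∫ ω, F ω ^ (-u - v) ∂P)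
        + (u + v + 1) *
          (∫ ω, F ω ^ (-u - v - 2) * (∫ y in (0 : ℝ)..L, Z y ^ 2 * X ω y ^ 2) ∂P) := by
  have hLmem : L ∈ Icc 0 L := ⟨hL.le, le_rfl⟩
  -- Positivity of `Z` lets it be absorbed into the exponent: `Z(x) e^{vx + W x} = e^{d(x) + W x}`
  -- on `[0, L]`.
  let d : ℝ → ℝ := fun x => Real.log (Z (projIcc 0 L hL.le x)) + v * x
  have hd : Continuous d := by
    have : Continuous fun x => Z (projIcc 0 L hL.le x) := hZ.domRestrict.comp _root_.continuous_projIcc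
    refine Continuous.add (this.log fun x => ?_) (by fun_prop)
    exact (hZpos _ (projIcc 0 L hL.le x).2).ne'
  have hZf (y : ℝ) (hy : y ∈ Icc 0 L) (ω : Ω) :
      Z y * expPath hL.le (fun x => v * x) W ω y = expPath hL.le d W ω y := by
    simp only [expPath, d, projIcc_of_mem hL.le hy]
    rw [Real.exp_add, Real.exp_add, Real.exp_add, Real.exp_log (hZpos y hy)]
    ring
  have hFeq (ω : Ω) : F ω = ∫ y in (0 : ℝ)..L, expPath hL.le d W ω y := by
    rw [hF]
    refine intervalIntegral.integral_congr fun y hy => ?_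
    rw [uIcc_of_le hL.le] at hy
    simp only [hX ω y hy, hZf y hy ω]
  have hf (ω : Ω) := hW.continuous_expPath hL.le hd ω
  have hf0 (ω : Ω) := expPath_pos hL.le d W ω
  have hFint (r : ℝ) : Integrable (fun ω => F ω ^ r) P := by
    simp only [hFeq]
    exact hW.integrable_rpow hL hd r
  obtain ⟨p, hp⟩ : ∃ p : ℝ, p = -u - v - 1 := ⟨_, rfl⟩
  set α := v + 1 / 2 with hα
  let g (j : ℕ) (ω : Ω) : ℝ → ℝ := tiltMoment L α p j (expPath hL.le d W ω)
  let m (ω : Ω) : ℝ → ℝ := tiltSource L α (p - 1) (expPath hL.le d W ω)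
  have momentSwap {h : ℝ → ℝ} (hh : ContinuousOn h (Icc 0 L)) (j : ℕ) :=
    integral_intervalIntegral_eq (P := P) hL.le hh (hW.measurable_pathMoment hL.le hd v p j)
      (hW.measurable_tiltMoment hL.le hd α p j)
      (fun y hy ω => pathMoment_nonneg hL.le d W v p j hy ω)
      (fun y hy ω => tiltMoment_nonneg hL (hf ω) (hf0 ω) α p j hy)
      (fun y hy => hW.lintegral_pathMoment hL.le hd v p j hy)
      (hW.integrable_tiltMoment hL hd α p j)
  have sourceSwap := integral_intervalIntegral_eq (P := P) hL.le hZ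
      (hW.measurable_pathSource hL.le hd v (p - 1)) (hW.measurable_tiltSource hL.le hd α (p - 1))
      (fun y hy ω => pathSource_nonneg hL.le d W v (p - 1) y ω)
      (fun y hy ω => tiltSource_nonneg hL (hf ω) (hf0 ω) α (p - 1) hy)
      (fun y hy => hW.lintegral_pathSource hL.le hd v (p - 1) hy)
      (hW.integrable_tiltSource hL hd α (p - 1))
  have e2 (ω : Ω) : ∫ y in (0 : ℝ)..L, Z₂ y * pathMoment hL.le d W v p 0 y ω =
      F ω ^ p * ∫ y in (0 : ℝ)..L, Z₂ y * X ω y := by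
    rw [← intervalIntegral.integral_const_mul]
    refine intervalIntegral.integral_congr fun y hy => ?_
    rw [uIcc_of_le hL.le] at hy
    simp only [pathMoment, hFeq, hX ω y hy, pow_zero, Nat.cast_zero, sub_zero]
    ring
  have eZ (j : ℕ) (ω : Ω) : ∫ y in (0 : ℝ)..L, Z y * pathMoment hL.le d W v p j y ω =
      F ω ^ (p + 1) / (j + 1) := by
    rw [hW.integral_mul_pathMoment hL hd hZf, hFeq]
  have eS (ω : Ω) : ∫ y in (0 : ℝ)..L, Z y * pathSource hL.le d W v (p - 1) y ω =
      F ω ^ (p - 1) * ∫ y in (0 : ℝ)..L, Z y ^ 2 * X ω y ^ 2 := by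
    rw [← intervalIntegral.integral_const_mul]
    refine intervalIntegral.integral_congr fun y hy => ?_
    rw [uIcc_of_le hL.le] at hy
    simp only [pathSource, hFeq, hX ω y hy, ← hZf y hy ω]
    ring
  have eL (ω : Ω) : pathMoment hL.le d W v p 0 L ω = F ω ^ p * X ω L := by
    simp only [pathMoment, hFeq, hX ω L hLmem, pow_zero, Nat.cast_zero, sub_zero]
    ring
  have eg0 (ω : Ω) : g 0 ω 0 = F ω ^ p := by
    simp [g, tiltMoment, tiltTotal_zero, hFeq]
  have mL : Measurable fun ω => pathMoment hL.le d W v p 0 L ω :=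
    (hW.measurable_pathMoment hL.le hd v p 0).comp measurable_prodMk_left
  have mgL : Measurable fun ω => g 0 ω L :=
    (hW.measurable_tiltMoment hL.le hd α p 0).comp measurable_prodMk_left
  have pL0 (ω : Ω) := pathMoment_nonneg hL.le d W v p 0 hLmem ω
  have gL0 (ω : Ω) : 0 ≤ g 0 ω L := tiltMoment_nonneg hL (hf ω) (hf0 ω) α p 0 hLmem
  have gLint : Integrable (fun ω => g 0 ω L) P := by
    refine Integrable.mono' (((hFint p).const_mul (Real.exp L ^ |p|)).const_mul
      (Real.exp (|α| * L))) mgL.aestronglyMeasurable (Eventually.of_forall fun ω => ?_)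
    rw [Real.norm_of_nonneg (gL0 ω), hFeq]
    exact tiltMoment_le hL (hf ω) (hf0 ω) α p 0 hLmem
  -- Only the boundary term at `L` needs untilting; at `0` the shift is trivial and `g 0 ω 0` is
  -- already `F^p`.
  have swapL := hW.lintegral_pathMoment hL.le hd v p 0 hLmem
  have iL := integrable_of_lintegral_eq mL pL0 gL0 swapL gLint
  have EL := integral_eq_of_lintegral_eq mL pL0 mgL gL0 swapL
  -- The boundary conditions on `g 1` hold since `K(0) = 0` and `K(L) = H(L)`.
  have pathwise (ω : Ω) := integral_mul_eq_of_linear_system (s := -p) (α := α + p)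
    (β := α + p - 1) (g := g 0 ω) (k := g 1 ω) (m := m ω) (n := g 2 ω) hL.le hZ hZ₁ hZ₂ hZZ₁ hZ₁Z₂
    h0 h1 (continuousOn_tiltMoment hL (hf ω) (hf0 ω) α p 0)
    (continuousOn_tiltMoment hL (hf ω) (hf0 ω) α p 1)
    (continuousOn_tiltSource hL (hf ω) (hf0 ω) α (p - 1))
    (continuousOn_tiltMoment hL (hf ω) (hf0 ω) α p 2)
    (fun x hx => hasDerivAt_tiltMoment_zero hL (hf ω) (hf0 ω) α p (Ioo_subset_Icc_self hx))
    (fun x hx => hasDerivAt_tiltMoment_one hL (hf ω) (hf0 ω) α p (Ioo_subset_Icc_self hx))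
    (by simp [g, tiltMoment, tiltPart_zero])
    (by
      have hH := tiltTotal_pos hL (hf ω) (hf0 ω) hLmem
      simp only [g, tiltMoment, ← tiltTotal_right (L := L), Nat.cast_one, Nat.cast_zero, pow_one,
        pow_zero, sub_zero, mul_one, Real.rpow_sub_one hH.ne', div_mul_cancel₀ _ hH.ne'])
  simp only [eg0] at pathwise
  obtain ⟨i2, -, E2⟩ := momentSwap hZ₂ 0
  obtain ⟨-, ig0, E0⟩ := momentSwap hZ 0
  obtain ⟨-, ig1, E1⟩ := momentSwap hZ 1
  obtain ⟨-, ig2, E3⟩ := momentSwap hZ 2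
  obtain ⟨iS, igS, ES⟩ := sourceSwap
  simp only [e2] at i2 E2
  simp only [eS] at iS ES
  simp only [eL] at iL EL
  simp only [eZ, integral_div] at E0 E1 E3
  have hp1 : -u - v = p + 1 := by rw [hp]; ring
  have hp2 : -u - v - 2 = p - 1 := by rw [hp]; ring
  rw [hp1, show p + 1 - 1 = p by ring, show p + 1 - 2 = p - 1 by ring]
  refine ⟨i2, iL, hFint p, hFint _, iS, ?_⟩
  have expectation : ∫ ω, (∫ y in (0 : ℝ)..L, Z₂ y * g 0 ω y) ∂P =
      -(α + p) * (Z L * (∫ ω, g 0 ω L ∂P) - Z 0 * (∫ ω, F ω ^ p ∂P)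
          - (α + p) * (∫ ω, (∫ y in (0 : ℝ)..L, Z y * g 0 ω y) ∂P)
          - (-p) * ∫ ω, (∫ y in (0 : ℝ)..L, Z y * g 1 ω y) ∂P)
        - (-p) * (Z L * (∫ ω, g 0 ω L ∂P)
          - (α + p - 1) * (∫ ω, (∫ y in (0 : ℝ)..L, Z y * g 1 ω y) ∂P)
          - (∫ ω, (∫ y in (0 : ℝ)..L, Z y * m ω y) ∂P)
          - (-p + 1) * ∫ ω, (∫ y in (0 : ℝ)..L, Z y * g 2 ω y) ∂P) := by
    simp only [pathwise]
    exact integral_linear_combination gLint (hFint p) ig0 ig1 igS ig2 ..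
  replace ES : _ = ∫ ω, (∫ y in (0 : ℝ)..L, Z y * m ω y) ∂P := ES
  rw [E2, ES, EL]
  refine expectation.trans ?_
  -- The integrals of `g 0`, `g 1`, `g 2` become `1`, `1/2`, `1/3` times `E[F^{p+1}]`. With `α + p =
  -- -(u + 1/2)` the rest is polynomial algebra in `u` and `v`.
  rw [← E0, ← E1, ← E3]
  simp only [hα, hp]
  push_cast
  ring

end Identity

/-! ### Transfer from the regular version to the given Brownian motion. -/

theorem lemma4p2 {Ω : Type*} [MeasurableSpace Ω] (P : Measure Ω) [IsProbabilityMeasure P]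
    (L : ℝ) (hL : 0 < L) (Z : ℝ → ℝ)
    (hZ : ContDiffOn ℝ 2 Z (Icc (0 : ℝ) L))
    (hZpos : ∀ x ∈ Icc (0 : ℝ) L, 0 < Z x)
    (hZ0 : derivWithin Z (Icc (0 : ℝ) L) 0 = 0)
    (hZL : derivWithin Z (Icc (0 : ℝ) L) L = 0)
    (B : ℝ → Ω → ℝ) (hB : IsStdBrownianOn L B P) (u v : ℝ) :
    Integrable (fun ω => expIntegral L Z B v 0 L ω ^ (-u - v - 1) * expIntegral L Z B v 2 L ω) P ∧
    Integrable (fun ω => expIntegral L Z B v 0 L ω ^ (-u - v - 1) *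
      Real.exp (driftedBM B v L ω)) P ∧
    Integrable (fun ω => expIntegral L Z B v 0 L ω ^ (-u - v - 1)) P ∧
    Integrable (fun ω => expIntegral L Z B v 0 L ω ^ (-u - v)) P ∧
    Integrable (fun ω => expIntegral L Z B v 0 L ω ^ (-u - v - 2) *
      ∫ y in (0 : ℝ)..L, Z y ^ 2 * Real.exp (2 * driftedBM B v y ω)) P ∧
    ∫ ω, expIntegral L Z B v 0 L ω ^ (-u - v - 1) * expIntegral L Z B v 2 L ω ∂P =
      -(v + 1 / 2) * Z L *
          (∫ ω, expIntegral L Z B v 0 L ω ^ (-u - v - 1) * Real.exp (driftedBM B v L ω) ∂P)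
        - (u + 1 / 2) * Z 0 * (∫ ω, expIntegral L Z B v 0 L ω ^ (-u - v - 1) ∂P)
        + (1 / 3 * u ^ 2 + 1 / 3 * v ^ 2 - 1 / 3 * u * v - 1 / 12) *
          (∫ ω, expIntegral L Z B v 0 L ω ^ (-u - v) ∂P)
        + (u + v + 1) *
          (∫ ω, expIntegral L Z B v 0 L ω ^ (-u - v - 2) *
            (∫ y in (0 : ℝ)..L, Z y ^ 2 * Real.exp (2 * driftedBM B v y ω)) ∂P) := by
  obtain ⟨W, hW, hBW⟩ := hB.exists_isRegularBrownian hL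
  have hU := uniqueDiffOn_Icc hL
  have d1 (x : ℝ) (hx : x ∈ Ioo 0 L) : HasDerivAt Z (derivWithin Z (Icc 0 L) x) x :=
    ((hZ.differentiableOn two_ne_zero x (Ioo_subset_Icc_self hx)).hasDerivWithinAt).hasDerivAt
      (Icc_mem_nhds hx.1 hx.2)
  have hdd : DifferentiableOn ℝ (derivWithin Z (Icc 0 L)) (Icc 0 L) := by
    have := hZ.differentiableOn_iteratedDerivWithin (m := 1) (by norm_num) hU
    rwa [iteratedDerivWithin_one] at this
  have h2 : iteratedDerivWithin 2 Z (Icc 0 L) =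
      derivWithin (derivWithin Z (Icc 0 L)) (Icc 0 L) := by
    rw [iteratedDerivWithin_succ', iteratedDerivWithin_one]
  have d2 (x : ℝ) (hx : x ∈ Ioo 0 L) :
      HasDerivAt (derivWithin Z (Icc 0 L)) (iteratedDerivWithin 2 Z (Icc 0 L) x) x := by
    rw [h2]
    exact ((hdd x (Ioo_subset_Icc_self hx)).hasDerivWithinAt).hasDerivAt (Icc_mem_nhds hx.1 hx.2)
  have main := hW.integral_identity hL hZ.continuousOn hdd.continuousOn
    (hZ.continuousOn_iteratedDerivWithin (m := 2) le_rfl hU) d1 d2 hZ0 hZL hZpos u v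
    (expPath hL.le (fun x => v * x) W · ·) (fun _ _ _ => rfl) _ (fun _ => rfl)
  have hX : ∀ᵐ ω ∂P, ∀ y ∈ Icc 0 L,
      Real.exp (driftedBM B v y ω) = expPath hL.le (fun x => v * x) W ω y := by
    filter_upwards [hBW] with ω hω y hy
    rw [expPath, projIcc_of_mem hL.le hy, ← hω ⟨y, hy⟩, driftedBM, add_comm]
  have hI (k : ℕ) : ∀ᵐ ω ∂P, expIntegral L Z B v k L ω = ∫ y in (0 : ℝ)..L,
      iteratedDerivWithin k Z (Icc 0 L) y * expPath hL.le (fun x => v * x) W ω y := by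
    filter_upwards [hX] with ω hω
    refine intervalIntegral.integral_congr fun y hy => ?_
    rw [uIcc_of_le hL.le] at hy
    simp only [hω y hy]
  have hI0 := hI 0
  simp only [iteratedDerivWithin_zero] at hI0
  have hS : ∀ᵐ ω ∂P, ∫ y in (0 : ℝ)..L, Z y ^ 2 * Real.exp (2 * driftedBM B v y ω) =
      ∫ y in (0 : ℝ)..L, Z y ^ 2 * expPath hL.le (fun x => v * x) W ω y ^ 2 := by
    filter_upwards [hX] with ω hω
    refine intervalIntegral.integral_congr fun y hy => ?_
    rw [uIcc_of_le hL.le] at hy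
    simp only [← hω y hy, ← Real.exp_nat_mul, Nat.cast_ofNat]
  obtain ⟨m1, m2, m3, m4, m5, m6⟩ := main
  have c1 := hI0.and (hI 2) |>.mono fun ω h => congrArg₂ (fun a b => a ^ (-u - v - 1) * b) h.1 h.2
  have c2 := hI0.and hX |>.mono fun ω h =>
    congrArg₂ (fun a b => a ^ (-u - v - 1) * b) h.1 (h.2 L ⟨hL.le, le_rfl⟩)
  have c3 := hI0.mono fun ω h => congrArg (fun a => a ^ (-u - v - 1)) h
  have c4 := hI0.mono fun ω h => congrArg (fun a => a ^ (-u - v)) h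
  have c5 := hI0.and hS |>.mono fun ω h => congrArg₂ (fun a b => a ^ (-u - v - 2) * b) h.1 h.2
  refine ⟨m1.congr (c1.mono fun _ h => h.symm), m2.congr (c2.mono fun _ h => h.symm),
    m3.congr (c3.mono fun _ h => h.symm), m4.congr (c4.mono fun _ h => h.symm),
    m5.congr (c5.mono fun _ h => h.symm), ?_⟩
  rw [integral_congr_ae c1, integral_congr_ae c2, integral_congr_ae c3, integral_congr_ae c4,
    integral_congr_ae c5]
  exact m6
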